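/- Formulas are built from atoms and $\bot$ with $\wedge,\vee,\to,\Box$; small Greek letters denote formulas and $\Gamma,\Delta,\Sigma,\bar C,\bar D$ finite multisets of formulas. The sets $V^{+}(\phi),V^{-}(\phi)$ of positive and negative variables are given by $V^+(p)=\{p\}$, $V^-(p)=V^{\pm}(\bot)=\varnothing$, $V^{\circ}(\phi\odot\psi)=V^{\circ}(\phi)\cup V^{\circ}(\psi)$ for $\odot\in\{\wedge,\vee\}$, $V^{\circ}(\phi\to\psi)=V^{\diamond}(\phi)\cup V^{\circ}(\psi)$ and $V^{\circ}(\Box\phi)=V^{\circ}(\phi)$, where $\circ\in\{+,-\}$ and $\diamond$ is the polarity dual to $\circ$. For a multiset, $V^{\circ}(\Gamma)=\bigcup_{\gamma\in\Gamma}V^{\circ}(\gamma)$. A sequent $S=(S^a\Rightarrow S^s)$ consists of two finite multisets of formulas; $V^{\circ}(S)=V^{\diamond}(S^a)\cup V^{\circ}(S^s)$, and $S\cdot T=(S^a, T^a\Rightarrow S^s, T^s)$. A formula $\phi$ is $p^{\circ}$-free if $p\notin V^{\circ}(\phi)$. The calculus $\mathbf{G4iM}$ derives only sequents whose succedent has at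 most one formula (single-conclusion sequents). Its axioms are $\Gamma,p\Rightarrow p$ ($p$ an atom) and $\Gamma,\bot\Rightarrow\Delta$ ($\Delta$ having at most one formula), and its rules (premises / conclusion) are: - $\Gamma,\phi,\psi\Rightarrow\Delta\ /\ \Gamma,\phi\wedge\psi\Rightarrow\Delta$; - $\Gamma\Rightarrow\phi$ and $\Gamma\Rightarrow\psi\ /\ \Gamma\Rightarrow\phi\wedge\psi$; - $\Gamma,\phi\Rightarrow\Delta$ and $\Gamma,\psi\Rightarrow\Delta\ /\ \Gamma,\phi\vee\psi\Rightarrow\Delta$; - $\Gamma\Rightarrow\phi_i\ /\ \Gamma\Rightarrow\phi_0\vee\phi_1$ ($i=0,1$); - $\Gamma,\phi\Rightarrow\psi\ /\ \Gamma\Rightarrow\phi\to\psi$; - $\Gamma,p,\psi\Rightarrow\Delta\ /\ \Gamma,p,p\to\psi\Rightarrow\Delta$ ($p$ an atom); - $\Gamma,\phi_1\to(\phi_2\to\psi)\Rightarrow\Delta\ /\ \Gamma,(\phi_1\wedge\phi_2)\to\psi\Rightarrow\Delta$; - $\Gamma,\phi_1\to\psi,\phi_2\to\psi\Rightarrow\Delta\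 /\ \Gamma,(\phi_1\vee\phi_2)\to\psi\Rightarrow\Delta$; - $\Gamma,\phi_2\to\psi\Rightarrow\phi_1\to\phi_2$ and $\Gamma,\psi\Rightarrow\Delta\ /\ \Gamma,(\phi_1\to\phi_2)\to\psi\Rightarrow\Delta$; - (weakening) $\Gamma\Rightarrow\Delta\ /\ \Gamma,\phi\Rightarrow\Delta$ and $\Gamma\Rightarrow\ /\ \Gamma\Rightarrow\phi$; - ($M$) $\phi\Rightarrow\psi\ /\ \Box\phi\Rightarrow\Box\psi$; - ($LM{\to}$) $\phi\Rightarrow\psi$ and $\Gamma,\Box\phi,\theta\Rightarrow\Delta\ /\ \Gamma,\Box\phi,\Box\psi\to\theta\Rightarrow\Delta$. **Theorem.** $\mathbf{G4iM}$ has the uniform Lyndon interpolation property: to all single-conclusion sequents $S$, multisets $\Sigma$, atoms $p$ and polarities $\circ\in\{+,-\}$ one can assign formulas $\forall^{\circ}p\,S$ and $\exists^{\circ}p\,\Sigma$ such that for all $S,\Sigma,p,\circ$, with $\diamond$ dual to $\circ$: - (var) $\forall^{\circ}p\,S$ and $\exists^{\circ}p\,\Sigma$ are $p^{\circ}$-free,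 and $V^{\dagger}(\forall^{\circ}p\,S)\subseteq V^{\dagger}(S)$ and $V^{\dagger}(\exists^{\circ}p\,\Sigma)\subseteq V^{\dagger}(\Sigma)$ for both $\dagger\in\{+,-\}$; - (i) $\Sigma\Rightarrow\exists^{\circ}p\,\Sigma$ is derivable; - (ii) for every sequent $\bar C\Rightarrow\bar D$ such that $\bar D$ has at most one formula and $p\notin V^{\circ}(\bar C\Rightarrow\bar D)$, if $\Sigma,\bar C\Rightarrow\bar D$ is derivable, then so is $\exists^{\circ}p\,\Sigma,\bar C\Rightarrow\bar D$; - (iii) $S\cdot(\forall^{\circ}p\,S\Rightarrow\ )$ is derivable; - (iv) for every multiset $\bar C$ with $p\notin V^{\circ}(\bar C)$, if $S\cdot(\bar C\Rightarrow\ )$ is derivable, then so is $\bar C,\exists^{\diamond}p\,S^a\Rightarrow\forall^{\circ}p\,S$. -/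

import Mathlib

namespace G4iM

universe u

/-- Formulas over a type `α` of atoms, with primitives `∧, ∨, →, □, ⊥`. -/
inductive Formula (α : Type u) : Type u
  | atom : α → Formula α
  | bot : Formula α
  | and : Formula α → Formula α → Formula α
  | or : Formula α → Formula α → Formula α
  | imp : Formula α → Formula α → Formula α
  | box : Formula α → Formula α

/-- The two polarities `+` and `-`. -/
inductive Polarity : Type
  | pos : Polarity
  | neg : Polarity

/-- The dual polarity. -/
def Polarity.dual : Polarity → Polarity
  | .pos => .neg
  | .neg => .pos

/-- `φ.vars .pos` and `φ.vars .neg` are the sets of positive and negative variables of `φ`. -/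
def Formula.vars {α : Type u} : Polarity → Formula α → Set α
  | .pos, .atom p => {p}
  | .neg, .atom _ => ∅
  | _, .bot => ∅
  | d, .and φ ψ => φ.vars d ∪ ψ.vars d
  | d, .or φ ψ => φ.vars d ∪ ψ.vars d
  | d, .imp φ ψ => φ.vars d.dual ∪ ψ.vars d
  | d, .box φ => φ.vars d

/-- Positive or negative variables of a finite multiset of formulas. -/
def multisetVars {α : Type u} (d : Polarity) (Γ : Multiset (Formula α)) : Set α :=
  {p | ∃ φ ∈ Γ, p ∈ φ.vars d}

/-- A sequent: antecedent and succedent are finite multisets of formulas. -/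
structure Sequent (α : Type u) : Type u where
  ant : Multiset (Formula α)
  suc : Multiset (Formula α)

/-- A sequent is single-conclusion if its succedent has at most one formula. -/
def Sequent.IsSingleConclusion {α : Type u} (S : Sequent α) : Prop :=
  Multiset.card S.suc ≤ 1

/-- The multiplication of sequents joins antecedents and succedents (adding multiplicities). -/
def Sequent.mul {α : Type u} (S T : Sequent α) : Sequent α :=
  ⟨S.ant + T.ant, S.suc + T.suc⟩

/-- Positive or negative variables of a sequent: polarities are reversed in the antecedent. -/
def Sequent.vars {α : Type u} (d : Polarity) (S : Sequent α) : Set α :=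
  multisetVars d.dual S.ant ∪ multisetVars d S.suc

open Formula in
/-- Derivability in the single-conclusion calculus `G4iM`. Here `φ ::ₘ Γ` is `Γ, φ`, and `⟨Γ, Δ⟩`
is `Γ ⇒ Δ`. Every derivable sequent is single-conclusion, because the axioms are and the rules
do not change this. -/
inductive Derivable {α : Type u} : Sequent α → Prop
  | ax (Γ : Multiset (Formula α)) (p : α) :
      Derivable ⟨atom p ::ₘ Γ, {atom p}⟩
  | botL (Γ Δ : Multiset (Formula α)) (hΔ : Multiset.card Δ ≤ 1) :
      Derivable ⟨bot ::ₘ Γ, Δ⟩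
  | andL (Γ Δ : Multiset (Formula α)) (φ ψ : Formula α) :
      Derivable ⟨φ ::ₘ ψ ::ₘ Γ, Δ⟩ → Derivable ⟨and φ ψ ::ₘ Γ, Δ⟩
  | andR (Γ : Multiset (Formula α)) (φ ψ : Formula α) :
      Derivable ⟨Γ, {φ}⟩ → Derivable ⟨Γ, {ψ}⟩ → Derivable ⟨Γ, {and φ ψ}⟩
  | orL (Γ Δ : Multiset (Formula α)) (φ ψ : Formula α) :
      Derivable ⟨φ ::ₘ Γ, Δ⟩ → Derivable ⟨ψ ::ₘ Γ, Δ⟩ → Derivable ⟨or φ ψ ::ₘ Γ, Δ⟩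
  | orR₀ (Γ : Multiset (Formula α)) (φ ψ : Formula α) :
      Derivable ⟨Γ, {φ}⟩ → Derivable ⟨Γ, {or φ ψ}⟩
  | orR₁ (Γ : Multiset (Formula α)) (φ ψ : Formula α) :
      Derivable ⟨Γ, {ψ}⟩ → Derivable ⟨Γ, {or φ ψ}⟩
  | impR (Γ : Multiset (Formula α)) (φ ψ : Formula α) :
      Derivable ⟨φ ::ₘ Γ, {ψ}⟩ → Derivable ⟨Γ, {imp φ ψ}⟩
  | atomImpL (Γ Δ : Multiset (Formula α)) (p : α) (ψ : Formula α) :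
      Derivable ⟨atom p ::ₘ ψ ::ₘ Γ, Δ⟩ →
        Derivable ⟨atom p ::ₘ imp (atom p) ψ ::ₘ Γ, Δ⟩
  | andImpL (Γ Δ : Multiset (Formula α)) (φ₁ φ₂ ψ : Formula α) :
      Derivable ⟨imp φ₁ (imp φ₂ ψ) ::ₘ Γ, Δ⟩ →
        Derivable ⟨imp (and φ₁ φ₂) ψ ::ₘ Γ, Δ⟩
  | orImpL (Γ Δ : Multiset (Formula α)) (φ₁ φ₂ ψ : Formula α) :
      Derivable ⟨imp φ₁ ψ ::ₘ imp φ₂ ψ ::ₘ Γ, Δ⟩ →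
        Derivable ⟨imp (or φ₁ φ₂) ψ ::ₘ Γ, Δ⟩
  | impImpL (Γ Δ : Multiset (Formula α)) (φ₁ φ₂ ψ : Formula α) :
      Derivable ⟨imp φ₂ ψ ::ₘ Γ, {imp φ₁ φ₂}⟩ → Derivable ⟨ψ ::ₘ Γ, Δ⟩ →
        Derivable ⟨imp (imp φ₁ φ₂) ψ ::ₘ Γ, Δ⟩
  | weakL (Γ Δ : Multiset (Formula α)) (φ : Formula α) :
      Derivable ⟨Γ, Δ⟩ → Derivable ⟨φ ::ₘ Γ, Δ⟩
  | weakR (Γ : Multiset (Formula α)) (φ : Formula α) :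
      Derivable ⟨Γ, 0⟩ → Derivable ⟨Γ, {φ}⟩
  | boxM (φ ψ : Formula α) :
      Derivable ⟨{φ}, {ψ}⟩ → Derivable ⟨{box φ}, {box ψ}⟩
  | boxImpL (Γ Δ : Multiset (Formula α)) (φ ψ θ : Formula α) :
      Derivable ⟨{φ}, {ψ}⟩ → Derivable ⟨box φ ::ₘ θ ::ₘ Γ, Δ⟩ →
        Derivable ⟨box φ ::ₘ imp (box ψ) θ ::ₘ Γ, Δ⟩

end G4iM

namespace G4iM

universe u

variable {α : Type u}

/-! ### Splitting multisets and weights of formulas -/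

/-! The interpolants come from Pitts' method. Premises of the logical rules weigh less than their
conclusions, so one can define by recursion on weight an existential interpolant `E` of `Γ`, a
conjunction, and a universal interpolant `A` of `S`, a disjunction. They have one clause for each
way in which a last rule can act on formulas of `Γ` or `S`, built from the interpolants of the
premises; a clause that would put `p` at the forbidden polarity is left out. Every conjunct follows
from `Γ` and every disjunct yields `S`, which gives (i), (iii) and the variable conditions
(`conjuncts_spec`, `leftDisjuncts_spec`, `rightDisjuncts_spec`).

For (ii) and (iv), take a derivation of the sequent with its `p`-free context and induct on it
(`exists_strong`, `forall_weak`). A rule acting on the context alone is replayed, and a rule acting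
on `Γ` or `S` is matched by a clause. When the two principal formulas of `atomImpL` or `boxImpL` are
split between `Γ` and the context, `p`-freeness of the context guarantees that the needed clause is
present.

Combining these steps requires cut and inversions of rules. They are obtained from semantics: `G4iM`
is sound (`Derivable.valid`) and complete (`Valid.derivable`) for intuitionistic monotone
neighbourhood models. Completeness is an induction on weight that glues the countermodels of all
smaller underivable sequents under a new root. Afterwards derivations are analysed only in
hypotheses, and conclusions are argued in models. -/

theorem cons_eq_add_split {β : Type*} {a : β} {s t r : Multiset β} (h : s + t = a ::ₘ r) :
    (∃ s', s = a ::ₘ s' ∧ r = s' + t) ∨ (∃ t', t = a ::ₘ t' ∧ r = s + t') := by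
  have ha : a ∈ s + t := h ▸ Multiset.mem_cons_self a r
  rcases Multiset.mem_add.1 ha with ha | ha
  · obtain ⟨s', rfl⟩ := Multiset.exists_cons_of_mem ha
    rw [Multiset.cons_add] at h
    exact .inl ⟨s', rfl, ((Multiset.cons_inj_right a).1 h).symm⟩
  · obtain ⟨t', rfl⟩ := Multiset.exists_cons_of_mem ha
    rw [Multiset.add_cons] at h
    exact .inr ⟨t', rfl, ((Multiset.cons_inj_right a).1 h).symm⟩

/-- A weight that decreases from the conclusion to the premises of each logical rule. -/
def Formula.weight : Formula α → ℕ
  | .atom _ => 2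
  | .bot => 2
  -- The product matches currying; the extra summand makes `φ → (ψ → θ)` strictly lighter than `(φ ∧
  -- ψ) → θ`.
  | .and φ ψ => φ.weight * ψ.weight + φ.weight
  | .or φ ψ => φ.weight + ψ.weight + 1
  | .imp φ ψ => φ.weight * ψ.weight + 1
  | .box φ => φ.weight + 1

theorem Formula.two_le_weight : ∀ φ : Formula α, 2 ≤ φ.weight
  | .atom _ => le_rfl
  | .bot => le_rfl
  | .and φ ψ => by
    have := φ.two_le_weight; have := ψ.two_le_weight; simp only [weight]; nlinarith
  | .or φ ψ => by
    have := φ.two_le_weight; have := ψ.two_le_weight; simp only [weight]; omega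
  | .imp φ ψ => by
    have := φ.two_le_weight; have := ψ.two_le_weight; simp only [weight]; nlinarith
  | .box φ => by have := φ.two_le_weight; simp only [weight]; omega

/-- The total weight of a multiset of formulas. -/
def multisetWeight (Γ : Multiset (Formula α)) : ℕ := (Γ.map Formula.weight).sum

@[simp] theorem multisetWeight_zero : multisetWeight (0 : Multiset (Formula α)) = 0 := rfl

@[simp] theorem multisetWeight_cons (φ : Formula α) (Γ : Multiset (Formula α)) :
    multisetWeight (φ ::ₘ Γ) = φ.weight + multisetWeight Γ := by
  simp [multisetWeight]

@[simp] theorem multisetWeight_singleton (φ : Formula α) :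
    multisetWeight {φ} = φ.weight := by
  simp [multisetWeight]

namespace Formula

theorem weight_and_lt (φ ψ : Formula α) : φ.weight + ψ.weight < (φ.and ψ).weight := by
  have := φ.two_le_weight; have := ψ.two_le_weight; simp only [weight]; nlinarith

theorem weight_or_lt (φ ψ : Formula α) : φ.weight + ψ.weight < (φ.or ψ).weight := by
  simp only [weight]; omega

theorem weight_imp_lt (φ ψ : Formula α) : φ.weight + ψ.weight < (φ.imp ψ).weight := by
  have := φ.two_le_weight; have := ψ.two_le_weight; simp only [weight]; nlinarith

theorem weight_box_lt (φ : Formula α) : φ.weight < φ.box.weight := by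
  simp only [weight]; omega

theorem weight_and_imp_lt (φ ψ θ : Formula α) :
    (φ.imp (ψ.imp θ)).weight < ((φ.and ψ).imp θ).weight := by
  have := φ.two_le_weight; have := θ.two_le_weight; simp only [weight]; nlinarith

theorem weight_or_imp_lt (φ ψ θ : Formula α) :
    (φ.imp θ).weight + (ψ.imp θ).weight < ((φ.or ψ).imp θ).weight := by
  have := θ.two_le_weight; simp only [weight]; nlinarith

/-- For weights `a, b, c ≥ 2` this reads `bc + ab + 2 < abc + c + 1`, which follows from `a + c ≤
ac`. A sum is bounded because the left premise of `impImpL` also has a new succedent, and the old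
one may be empty. -/
theorem weight_imp_imp_lt (φ ψ θ : Formula α) :
    (ψ.imp θ).weight + (φ.imp ψ).weight < ((φ.imp ψ).imp θ).weight := by
  have ha := φ.two_le_weight; have hb := ψ.two_le_weight; have hc := θ.two_le_weight
  simp only [weight]
  obtain ⟨a, ha⟩ := Nat.exists_eq_add_of_le ha
  obtain ⟨c, hc⟩ := Nat.exists_eq_add_of_le hc
  rw [ha, hc]
  nlinarith [Nat.zero_le (a * c * ψ.weight), Nat.zero_le (a * ψ.weight),
    Nat.zero_le (c * ψ.weight)]

end Formula

/-! ### Models -/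

/-- Intuitionistic monotone neighbourhood models. -/
structure Model (α : Type u) where
  World : Type u
  le : World → World → Prop
  le_refl : ∀ w, le w w
  le_trans : ∀ {x y z}, le x y → le y z → le x z
  val : World → α → Prop
  val_mono : ∀ {v w q}, le v w → val v q → val w q
  nbhd : World → Set World → Prop
  nbhd_superset : ∀ {w X Y}, X ⊆ Y → nbhd w X → nbhd w Y
  nbhd_mono : ∀ {v w X}, le v w → nbhd v X → nbhd w X

/-- `M.Force w φ` says that the formula `φ` is forced at the world `w`. -/
def Model.Force (M : Model α) : M.World → Formula α → Prop
  | w, .atom q => M.val w q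
  | _, .bot => False
  | w, .and φ ψ => M.Force w φ ∧ M.Force w ψ
  | w, .or φ ψ => M.Force w φ ∨ M.Force w ψ
  | w, .imp φ ψ => ∀ v, M.le w v → M.Force v φ → M.Force v ψ
  | w, .box φ => M.nbhd w {v | M.Force v φ}

theorem Model.Force.mono {M : Model α} {φ : Formula α} {v w : M.World} (h : M.le v w)
    (hφ : M.Force v φ) : M.Force w φ := by
  induction φ with
  | atom q => exact M.val_mono h hφ
  | bot => exact hφ
  | and φ ψ ihφ ihψ => exact ⟨ihφ hφ.1, ihψ hφ.2⟩
  | or φ ψ ihφ ihψ => exact hφ.imp ihφ ihψ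
  | imp φ ψ _ _ => exact fun x hx => hφ x (M.le_trans h hx)
  | box φ _ => exact M.nbhd_mono h hφ

theorem Model.Force.mp {M : Model α} {φ ψ : Formula α} {w : M.World}
    (h : M.Force w (φ.imp ψ)) (hφ : M.Force w φ) : M.Force w ψ :=
  h w (M.le_refl w) hφ

/-- A sequent is valid if every world that forces its antecedent forces a formula of its
succedent. -/
def Valid (S : Sequent α) : Prop :=
  ∀ (M : Model α) (w : M.World), (∀ φ ∈ S.ant, M.Force w φ) → ∃ ψ ∈ S.suc, M.Force w ψ

theorem Valid.force {φ ψ : Formula α} (h : Valid ⟨{φ}, {ψ}⟩) {M : Model α} {w : M.World}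
    (hφ : M.Force w φ) : M.Force w ψ := by
  simpa using h M w (by simpa using hφ)

theorem Valid.of_mem {Γ : Multiset (Formula α)} {φ : Formula α} (h : φ ∈ Γ) :
    Valid ⟨Γ, {φ}⟩ :=
  fun _ _ hw => ⟨φ, Multiset.mem_singleton_self φ, hw φ h⟩

/-- A simultaneous cut on all formulas of `Γ`, immediate in models. -/
theorem Valid.trans {Γ Θ Δ : Multiset (Formula α)} (h : Valid ⟨Γ, Δ⟩)
    (hΘ : ∀ φ ∈ Γ, Valid ⟨Θ, {φ}⟩) : Valid ⟨Θ, Δ⟩ :=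
  fun M w hw => h M w fun φ hφ => by simpa using hΘ φ hφ M w hw

/-! ### Validity is preserved by the rules -/

namespace Valid

variable {Γ Δ : Multiset (Formula α)} {φ ψ θ : Formula α}

theorem botL : Valid ⟨Formula.bot ::ₘ Γ, Δ⟩ :=
  fun _ _ hw => (hw _ (Multiset.mem_cons_self _ _)).elim

theorem andL (h : Valid ⟨φ ::ₘ ψ ::ₘ Γ, Δ⟩) : Valid ⟨φ.and ψ ::ₘ Γ, Δ⟩ := by
  intro M w hw
  simp only [Multiset.forall_mem_cons, Model.Force] at hw
  exact h M w (by simpa [and_assoc] using hw)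

theorem andR (h₁ : Valid ⟨Γ, {φ}⟩) (h₂ : Valid ⟨Γ, {ψ}⟩) : Valid ⟨Γ, {φ.and ψ}⟩ := by
  intro M w hw
  exact ⟨_, Multiset.mem_singleton_self _, by simpa using h₁ M w hw, by simpa using h₂ M w hw⟩

theorem orL (h₁ : Valid ⟨φ ::ₘ Γ, Δ⟩) (h₂ : Valid ⟨ψ ::ₘ Γ, Δ⟩) :
    Valid ⟨φ.or ψ ::ₘ Γ, Δ⟩ := by
  intro M w hw
  simp only [Multiset.forall_mem_cons] at hw
  rcases hw with ⟨hφ | hψ, hw⟩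
  · exact h₁ M w (by simpa using ⟨hφ, hw⟩)
  · exact h₂ M w (by simpa using ⟨hψ, hw⟩)

theorem orR₀ (h : Valid ⟨Γ, {φ}⟩) : Valid ⟨Γ, {φ.or ψ}⟩ :=
  fun M w hw => ⟨_, Multiset.mem_singleton_self _, .inl (by simpa using h M w hw)⟩

theorem orR₁ (h : Valid ⟨Γ, {ψ}⟩) : Valid ⟨Γ, {φ.or ψ}⟩ :=
  fun M w hw => ⟨_, Multiset.mem_singleton_self _, .inr (by simpa using h M w hw)⟩

theorem impR (h : Valid ⟨φ ::ₘ Γ, {ψ}⟩) : Valid ⟨Γ, {φ.imp ψ}⟩ := by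
  intro M w hw
  refine ⟨_, Multiset.mem_singleton_self _, fun v hv hφ => ?_⟩
  simpa using h M v (by simpa using ⟨hφ, fun χ hχ => (hw χ hχ).mono hv⟩)

/-- The common source of soundness for `atomImpL`, `impImpL` and `boxImpL`. -/
theorem impL (h₁ : Valid ⟨φ.imp ψ ::ₘ Γ, {φ}⟩) (h₂ : Valid ⟨ψ ::ₘ Γ, Δ⟩) :
    Valid ⟨φ.imp ψ ::ₘ Γ, Δ⟩ := by
  intro M w hw
  have hφ : M.Force w φ := by simpa using h₁ M w hw
  simp only [Multiset.forall_mem_cons] at hw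
  exact h₂ M w (by simpa using ⟨hw.1.mp hφ, hw.2⟩)

theorem andImpL (h : Valid ⟨φ.imp (ψ.imp θ) ::ₘ Γ, Δ⟩) :
    Valid ⟨(φ.and ψ).imp θ ::ₘ Γ, Δ⟩ := by
  intro M w hw
  simp only [Multiset.forall_mem_cons] at hw
  refine h M w ?_
  simp only [Multiset.forall_mem_cons]
  exact ⟨fun v hv hφ x hx hψ => hw.1 x (M.le_trans hv hx) ⟨hφ.mono hx, hψ⟩, hw.2⟩

theorem orImpL (h : Valid ⟨φ.imp θ ::ₘ ψ.imp θ ::ₘ Γ, Δ⟩) :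
    Valid ⟨(φ.or ψ).imp θ ::ₘ Γ, Δ⟩ := by
  intro M w hw
  simp only [Multiset.forall_mem_cons] at hw
  refine h M w ?_
  simp only [Multiset.forall_mem_cons]
  exact ⟨fun v hv hφ => hw.1 v hv (.inl hφ), fun v hv hψ => hw.1 v hv (.inr hψ), hw.2⟩

theorem impImpL (h₁ : Valid ⟨ψ.imp θ ::ₘ Γ, {φ.imp ψ}⟩) (h₂ : Valid ⟨θ ::ₘ Γ, Δ⟩) :
    Valid ⟨(φ.imp ψ).imp θ ::ₘ Γ, Δ⟩ := by
  refine impL (fun M w hw => h₁ M w ?_) h₂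
  simp only [Multiset.forall_mem_cons] at hw ⊢
  exact ⟨fun v hv hψ => hw.1 v hv fun x hx _ => hψ.mono hx, hw.2⟩

theorem weakL (h : Valid ⟨Γ, Δ⟩) : Valid ⟨φ ::ₘ Γ, Δ⟩ :=
  fun M w hw => h M w fun χ hχ => hw χ (Multiset.mem_cons_of_mem hχ)

theorem weakR (h : Valid ⟨Γ, 0⟩) : Valid ⟨Γ, Δ⟩ := by
  intro M w hw
  simpa using h M w hw

theorem boxM (h : Valid ⟨{φ}, {ψ}⟩) : Valid ⟨{φ.box}, {ψ.box}⟩ := by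
  intro M w hw
  refine ⟨_, Multiset.mem_singleton_self _, ?_⟩
  exact M.nbhd_superset (fun v hv => h.force hv) (hw _ (Multiset.mem_singleton_self _))

end Valid

theorem Derivable.valid {S : Sequent α} (h : Derivable S) : Valid S := by
  induction h with
  | ax Γ p => exact .of_mem (Multiset.mem_cons_self _ _)
  | botL => exact .botL
  | andL _ _ _ _ _ ih => exact .andL ih
  | andR _ _ _ _ _ ih₁ ih₂ => exact .andR ih₁ ih₂
  | orL _ _ _ _ _ _ ih₁ ih₂ => exact .orL ih₁ ih₂
  | orR₀ _ _ _ _ ih => exact .orR₀ ih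
  | orR₁ _ _ _ _ ih => exact .orR₁ ih
  | impR _ _ _ _ ih => exact .impR ih
  | atomImpL Γ Δ p ψ _ ih =>
    rw [Multiset.cons_swap] at ih ⊢
    exact .impL (.of_mem (by simp)) ih
  | andImpL _ _ _ _ _ _ ih => exact .andImpL ih
  | orImpL _ _ _ _ _ _ ih => exact .orImpL ih
  | impImpL _ _ _ _ _ _ _ ih₁ ih₂ => exact .impImpL ih₁ ih₂
  | weakL _ _ _ _ ih => exact .weakL ih
  | weakR _ _ _ ih => exact .weakR ih
  | boxM _ _ _ ih => exact .boxM ih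
  | boxImpL Γ Δ φ ψ θ _ _ ih₁ ih₂ =>
    rw [Multiset.cons_swap] at ih₂ ⊢
    exact .impL (ih₁.boxM.trans fun _ hχ => .of_mem (by simp_all)) ih₂

/-! ### Completeness -/

/-- The world `w` of `M` refutes the sequent `S`. -/
def Model.Refutes (M : Model α) (w : M.World) (S : Sequent α) : Prop :=
  (∀ φ ∈ S.ant, M.Force w φ) ∧ ∀ ψ ∈ S.suc, ¬ M.Force w ψ

/-- The order of the disjoint union of the models `M i` with a new root. -/
def glueLe {ι : Type u} (M : ι → Model α) (Γ : Multiset (Formula α)) :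
    Option (Σ i, (M i).World) → Option (Σ i, (M i).World) → Prop
  | none, none => True
  | none, some w => ∀ φ ∈ Γ, (M w.1).Force w.2 φ
  | some _, none => False
  | some v, some w => ∃ h : v.1 = w.1, (M w.1).le (h ▸ v.2) w.2

/-- The disjoint union of the models `M i`, with a new root below all the worlds that
force `Γ`. -/
def glue {ι : Type u} (M : ι → Model α) (Γ : Multiset (Formula α)) : Model α where
  World := Option (Σ i, (M i).World)
  le := glueLe M Γ
  le_refl := by
    rintro (_ | ⟨i, w⟩)
    · trivial
    · exact ⟨rfl, (M i).le_refl w⟩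
  le_trans := by
    rintro (_ | ⟨i, x⟩) (_ | ⟨j, y⟩) (_ | ⟨k, z⟩) h₁ h₂
    · trivial
    · exact h₂
    · exact h₂.elim
    · obtain ⟨h, h₂⟩ := h₂
      cases h
      exact fun φ hφ => (h₁ φ hφ).mono h₂
    · exact h₁.elim
    · exact h₁.elim
    · exact h₂.elim
    · obtain ⟨h, h₁⟩ := h₁
      obtain ⟨h', h₂⟩ := h₂
      cases h
      cases h'
      exact ⟨rfl, (M _).le_trans h₁ h₂⟩
  val w q := match w with
    | none => .atom q ∈ Γ
    | some w => (M w.1).val w.2 q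
  val_mono := by
    rintro (_ | ⟨i, x⟩) (_ | ⟨j, y⟩) q h hq
    · exact hq
    · exact h _ hq
    · exact h.elim
    · obtain ⟨h, h₁⟩ := h
      cases h
      exact (M _).val_mono h₁ hq
  -- The root's neighbourhoods are generated by the boxed formulas of `Γ`. The worlds of all
  -- components count, not only those above the root, because the premise `φ ⇒ ψ` of the box rules
  -- carries no context.
  nbhd w X := match w with
    | none => ∃ φ, .box φ ∈ Γ ∧ ∀ w : Σ i, (M i).World, (M w.1).Force w.2 φ → some w ∈ X
    | some w => (M w.1).nbhd w.2 {v | some ⟨w.1, v⟩ ∈ X}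
  nbhd_superset := by
    rintro (_ | ⟨i, x⟩) X Y h hX
    · obtain ⟨φ, hφ, hX⟩ := hX
      exact ⟨φ, hφ, fun w hw => h (hX w hw)⟩
    · exact (M i).nbhd_superset (fun v hv => h hv) hX
  nbhd_mono := by
    rintro (_ | ⟨i, x⟩) (_ | ⟨j, y⟩) X h hX
    · exact hX
    · obtain ⟨φ, hφ, hX⟩ := hX
      exact (M j).nbhd_superset (fun v hv => hX ⟨j, v⟩ hv) (h _ hφ)
    · exact h.elim
    · obtain ⟨h, h₁⟩ := h
      cases h
      exact (M _).nbhd_mono h₁ hX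

/-! ### Forcing at the root of the glued model -/

section glue

variable {ι : Type u} (M : ι → Model α) (Γ : Multiset (Formula α))

theorem glue_force_some (φ : Formula α) (i : ι) (w : (M i).World) :
    (glue M Γ).Force (some ⟨i, w⟩) φ ↔ (M i).Force w φ := by
  induction φ generalizing w with
  | atom q => exact Iff.rfl
  | bot => exact Iff.rfl
  | and φ ψ ihφ ihψ => exact and_congr (ihφ w) (ihψ w)
  | or φ ψ ihφ ihψ => exact or_congr (ihφ w) (ihψ w)
  | imp φ ψ ihφ ihψ =>
    constructor
    · exact fun h v hv hφ => (ihψ v).1 (h (some ⟨i, v⟩) ⟨rfl, hv⟩ ((ihφ v).2 hφ))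
    · rintro h (_ | ⟨j, v⟩) hv hφ
      · exact hv.elim
      · obtain ⟨h', hv⟩ := hv
        cases h'
        exact (ihψ v).2 (h v hv ((ihφ v).1 hφ))
  | box φ ih =>
    have : {v | (glue M Γ).Force (some ⟨i, v⟩) φ} = {v | (M i).Force v φ} :=
      Set.ext fun v => ih v
    exact Iff.of_eq (congrArg ((M i).nbhd w) this)

variable {M Γ}

/-- The world `w` lies above the root, so persistence would carry `φ` up to it. -/
theorem glue_not_force_none {φ : Formula α} {i : ι} {w : (M i).World}
    (hΓ : ∀ γ ∈ Γ, (M i).Force w γ) (hφ : ¬ (M i).Force w φ) :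
    ¬ (glue M Γ).Force none φ := fun h =>
  hφ ((glue_force_some M Γ φ i w).1 (h.mono (w := some ⟨i, w⟩) hΓ))

/-- Every other world above the root forces `Γ`, hence the implication; only the root itself is at
stake. -/
theorem glue_force_none_imp {φ ψ : Formula α} (hΓ : φ.imp ψ ∈ Γ)
    (h : ¬ (glue M Γ).Force none φ) : (glue M Γ).Force none (φ.imp ψ) := by
  rintro (_ | ⟨i, v⟩) hv hφ
  · exact (h hφ).elim
  · rw [glue_force_some] at hφ ⊢
    exact (hv _ hΓ).mp hφ

theorem glue_force_none_box {φ : Formula α} (hΓ : φ.box ∈ Γ) :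
    (glue M Γ).Force none φ.box :=
  ⟨φ, hΓ, fun w hw => (glue_force_some M Γ φ w.1 w.2).2 hw⟩

theorem glue_not_force_none_box {ψ : Formula α}
    (h : ∀ φ, φ.box ∈ Γ → ∃ i, ∃ w : (M i).World, (M i).Force w φ ∧ ¬ (M i).Force w ψ) :
    ¬ (glue M Γ).Force none ψ.box := by
  rintro ⟨φ, hφ, hX⟩
  obtain ⟨i, w, hw, hw'⟩ := h φ hφ
  exact hw' ((glue_force_some M Γ ψ i w).1 (hX ⟨i, w⟩ hw))

end glue

/-- The total weight of a sequent. -/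
def Sequent.weight (S : Sequent α) : ℕ := multisetWeight S.ant + multisetWeight S.suc

/-- The inductive step of the completeness theorem, for sequents to which no invertible left
rule applies: `M i` refutes the smaller underivable sequent `T i`. -/
theorem exists_refutes_of_irreducible {Γ Δ : Multiset (Formula α)}
    (hΔ : Multiset.card Δ ≤ 1) (hS : ¬ Derivable ⟨Γ, Δ⟩) {M : Sequent α → Model α}
    {w : ∀ T, (M T).World}
    (hM : ∀ T : Sequent α, T.weight < Sequent.weight ⟨Γ, Δ⟩ → T.IsSingleConclusion →
      ¬ Derivable T → (M T).Refutes (w T) T)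
    (hred : ∀ T : Sequent α, T.weight < Sequent.weight ⟨Γ, Δ⟩ → T.IsSingleConclusion →
      (∀ (N : Model α) (x : N.World), N.Refutes x T → N.Refutes x ⟨Γ, Δ⟩) → Derivable T) :
    (glue M Γ).Refutes none ⟨Γ, Δ⟩ := by
  simp only [Sequent.weight] at hM hred
  constructor
  · rintro (q | _ | ⟨a, b⟩ | ⟨a, b⟩ | ⟨a, b⟩ | a) hγ
    · exact hγ
    · obtain ⟨Γ', rfl⟩ := Multiset.exists_cons_of_mem hγ
      exact (hS (.botL _ _ hΔ)).elim
    · obtain ⟨Γ', rfl⟩ := Multiset.exists_cons_of_mem hγ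
      refine (hS (.andL _ _ _ _ (hred ⟨a ::ₘ b ::ₘ Γ', Δ⟩ ?_ hΔ ?_))).elim
      · have := a.weight_and_lt b
        simp only [multisetWeight_cons]; omega
      · intro N x hN
        simp only [Model.Refutes, Multiset.forall_mem_cons, Model.Force] at hN ⊢
        tauto
    · obtain ⟨Γ', rfl⟩ := Multiset.exists_cons_of_mem hγ
      have := a.weight_or_lt b
      refine (hS (.orL _ _ _ _ (hred ⟨a ::ₘ Γ', Δ⟩ ?_ hΔ ?_)
        (hred ⟨b ::ₘ Γ', Δ⟩ ?_ hΔ ?_))).elim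
      · simp only [multisetWeight_cons]; omega
      · intro N x hN
        simp only [Model.Refutes, Multiset.forall_mem_cons, Model.Force] at hN ⊢
        tauto
      · simp only [multisetWeight_cons]; omega
      · intro N x hN
        simp only [Model.Refutes, Multiset.forall_mem_cons, Model.Force] at hN ⊢
        tauto
    · refine glue_force_none_imp hγ ?_
      obtain ⟨Γ', rfl⟩ := Multiset.exists_cons_of_mem hγ
      -- Since `b` entails `a → b`, irreducibility makes this premise derivable. If `a` held at the
      -- root, a left implication rule would then derive the sequent.
      have hb : Derivable ⟨b ::ₘ Γ', Δ⟩ := by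
        refine hred ⟨b ::ₘ Γ', Δ⟩ ?_ hΔ fun N x hN => ?_
        · have := a.weight_imp_lt b
          simp only [multisetWeight_cons]; omega
        · simp only [Model.Refutes, Multiset.forall_mem_cons] at hN ⊢
          exact ⟨⟨fun v hv _ => hN.1.1.mono hv, hN.1.2⟩, hN.2⟩
      rcases a with q | _ | ⟨a, c⟩ | ⟨a, c⟩ | ⟨a, c⟩ | a
      · intro hq
        obtain ⟨Γ'', rfl⟩ := Multiset.exists_cons_of_mem
          ((Multiset.mem_cons.1 (show Formula.atom q ∈ _ from hq)).resolve_left (by simp))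
        rw [Multiset.cons_swap] at hS hb
        exact hS (.atomImpL _ _ _ _ hb)
      · exact id
      · refine (hS (.andImpL _ _ _ _ _
          (hred ⟨a.imp (c.imp b) ::ₘ Γ', Δ⟩ ?_ hΔ fun N x hN => ?_))).elim
        · have := a.weight_and_imp_lt c b
          simp only [multisetWeight_cons]; omega
        · simp only [Model.Refutes, Multiset.forall_mem_cons] at hN ⊢
          exact ⟨⟨fun v hv h => (hN.1.1 v hv h.1).mp h.2, hN.1.2⟩, hN.2⟩
      · refine (hS (.orImpL _ _ _ _ _
          (hred ⟨a.imp b ::ₘ c.imp b ::ₘ Γ', Δ⟩ ?_ hΔ fun N x hN => ?_))).elim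
        · have := a.weight_or_imp_lt c b
          simp only [multisetWeight_cons]; omega
        · simp only [Model.Refutes, Multiset.forall_mem_cons] at hN ⊢
          exact ⟨⟨fun v hv h => h.elim (hN.1.1 v hv) (hN.1.2.1 v hv), hN.1.2.2⟩, hN.2⟩
      · have hd : ¬ Derivable ⟨c.imp b ::ₘ Γ', {a.imp c}⟩ :=
          fun hd => hS (.impImpL _ _ _ _ _ hd hb)
        obtain ⟨hx₁, hx₂⟩ := hM _ (by
          have := a.weight_imp_imp_lt c b
          simp only [multisetWeight_cons, multisetWeight_singleton]; omega) (by
            simp [Sequent.IsSingleConclusion]) hd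
        simp only [Multiset.forall_mem_cons, Multiset.mem_singleton, forall_eq] at hx₁ hx₂
        simp only [Model.Force, not_forall] at hx₂
        obtain ⟨v, hv, ha, hc⟩ := hx₂
        -- The world `v` lies above the root: wherever `a → c` holds above `v`, so does `c`, because
        -- `a` does, and `c → b` gives `b`.
        refine glue_not_force_none (w := v) ?_ (fun h => hc (h.mp ha))
        simp only [Multiset.forall_mem_cons]
        exact ⟨fun y hy h => (hx₁.1.mono hv) y hy (h.mp (ha.mono hy)),
          fun γ hγ => (hx₁.2 γ hγ).mono hv⟩
      · refine glue_not_force_none_box fun φ hφ => ?_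
        replace hφ := (Multiset.mem_cons.1 hφ).resolve_left (by simp)
        obtain ⟨Γ'', rfl⟩ := Multiset.exists_cons_of_mem hφ
        have hd : ¬ Derivable ⟨{φ}, {a}⟩ := by
          intro hd
          rw [Multiset.cons_swap] at hS hb
          exact hS (.boxImpL _ _ _ _ _ hd hb)
        obtain ⟨hx₁, hx₂⟩ := hM _ (by
          have := φ.weight_box_lt
          have := a.weight_box_lt
          have := a.box.weight_imp_lt b
          simp only [multisetWeight_cons, multisetWeight_singleton]; omega) (by
            simp [Sequent.IsSingleConclusion]) hd
        exact ⟨_, _, hx₁ φ (by simp), hx₂ a (by simp)⟩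
    · exact glue_force_none_box hγ
  · intro δ hδ
    have hcard : Δ = {δ} := by
      obtain ⟨Δ', rfl⟩ := Multiset.exists_cons_of_mem hδ
      simp only [Multiset.card_cons, add_le_iff_nonpos_left, nonpos_iff_eq_zero,
        Multiset.card_eq_zero] at hΔ
      rw [hΔ]; rfl
    subst hcard
    have hroot : ∀ φ : Formula α, φ.weight < δ.weight → ¬ Derivable ⟨Γ, {φ}⟩ →
        ¬ (glue M Γ).Force none φ := by
      intro φ hφ hd
      obtain ⟨hx₁, hx₂⟩ := hM ⟨Γ, {φ}⟩ (by simpa using hφ) (by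
        simp [Sequent.IsSingleConclusion]) hd
      exact glue_not_force_none hx₁ (hx₂ φ (by simp))
    rcases δ with q | _ | ⟨a, b⟩ | ⟨a, b⟩ | ⟨a, b⟩ | a
    · intro hq
      obtain ⟨Γ', rfl⟩ := Multiset.exists_cons_of_mem (show Formula.atom q ∈ _ from hq)
      exact hS (.ax _ _)
    · exact id
    · have := a.weight_and_lt b
      rintro ⟨ha, hb⟩
      refine hS (.andR _ _ _ ?_ ?_) <;> by_contra hd
      · exact hroot a (by omega) hd ha
      · exact hroot b (by omega) hd hb
    · have := a.weight_or_lt b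
      rintro (h | h)
      · exact hroot a (by omega) (fun hd => hS (.orR₀ _ _ _ hd)) h
      · exact hroot b (by omega) (fun hd => hS (.orR₁ _ _ _ hd)) h
    · obtain ⟨hx₁, hx₂⟩ := hM ⟨a ::ₘ Γ, {b}⟩ (by
        have := a.weight_imp_lt b
        simp only [multisetWeight_cons, multisetWeight_singleton]; omega) (by
          simp [Sequent.IsSingleConclusion]) (fun hd => hS (.impR _ _ _ hd))
      simp only [Multiset.forall_mem_cons] at hx₁
      exact glue_not_force_none hx₁.2 fun h => hx₂ b (by simp) (h.mp hx₁.1)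
    · refine glue_not_force_none_box fun φ hφ => ?_
      obtain ⟨Γ', rfl⟩ := Multiset.exists_cons_of_mem hφ
      have hd : ¬ Derivable ⟨{φ}, {a}⟩ := by
        intro hd
        refine hS ?_
        have := Derivable.boxM _ _ hd
        clear hM hred hroot hS hδ hφ
        induction Γ' using Multiset.induction_on with
        | empty => exact this
        | cons χ Γ' ih => rw [Multiset.cons_swap]; exact .weakL _ _ _ ih
      obtain ⟨hx₁, hx₂⟩ := hM ⟨{φ}, {a}⟩ (by
        have := φ.weight_box_lt
        have := a.weight_box_lt
        simp only [multisetWeight_cons, multisetWeight_singleton]; omega) (by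
          simp [Sequent.IsSingleConclusion]) hd
      exact ⟨_, _, hx₁ φ (by simp), hx₂ a (by simp)⟩

/-- Every underivable single-conclusion sequent has a countermodel. -/
theorem exists_refutes (S : Sequent α) (hS : S.IsSingleConclusion) (h : ¬ Derivable S) :
    ∃ (M : Model α) (w : M.World), M.Refutes w S := by
  induction hn : S.weight using Nat.strong_induction_on generalizing S with
  | _ n ih =>
  -- Either no backward step to a smaller underivable sequent preserves refutations, and the models
  -- are glued, or such a step exists and its countermodel already serves.
  by_cases hred : ∀ T : Sequent α, T.weight < S.weight → T.IsSingleConclusion →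
      (∀ (N : Model α) (x : N.World), N.Refutes x T → N.Refutes x S) → Derivable T
  · have : ∀ T : Sequent α, ∃ (M : Model α) (w : M.World), T.weight < S.weight →
        T.IsSingleConclusion → ¬ Derivable T → M.Refutes w T := by
      intro T
      by_cases hT : T.weight < S.weight ∧ T.IsSingleConclusion ∧ ¬ Derivable T
      · obtain ⟨M, w, hw⟩ := ih _ (hn ▸ hT.1) T hT.2.1 hT.2.2 rfl
        exact ⟨M, w, fun _ _ _ => hw⟩
      · exact ⟨glue (ι := PEmpty) PEmpty.elim 0, none, fun h₁ h₂ h₃ => (hT ⟨h₁, h₂, h₃⟩).elim⟩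
    choose M w hM using this
    exact ⟨_, _, exists_refutes_of_irreducible hS h hM hred⟩
  · push Not at hred
    obtain ⟨T, hT, hT₁, hTS, hT₂⟩ := hred
    obtain ⟨M, w, hw⟩ := ih _ (hn ▸ hT) T hT₁ hT₂ rfl
    exact ⟨M, w, hTS M w hw⟩

theorem Valid.derivable {S : Sequent α} (hS : S.IsSingleConclusion) (h : Valid S) :
    Derivable S := by
  by_contra hd
  obtain ⟨M, w, hw⟩ := exists_refutes S hS hd
  obtain ⟨ψ, hψ, hf⟩ := h M w hw.1
  exact hw.2 ψ hψ hf

/-! ### Variables -/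

@[simp] theorem Polarity.dual_dual (d : Polarity) : d.dual.dual = d := by cases d <;> rfl

@[simp] theorem Polarity.dual_inj {c d : Polarity} : c.dual = d.dual ↔ c = d := by
  cases c <;> cases d <;> simp [Polarity.dual]

section vars

variable {q r : α} {c : Polarity} {φ ψ : Formula α} {Γ Δ : Multiset (Formula α)}

@[simp] theorem mem_vars_atom : q ∈ (Formula.atom r).vars c ↔ q = r ∧ c = .pos := by
  cases c <;> simp [Formula.vars]

@[simp] theorem mem_vars_bot : q ∈ (Formula.bot : Formula α).vars c ↔ False := by
  cases c <;> simp [Formula.vars]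

@[simp] theorem mem_vars_and : q ∈ (φ.and ψ).vars c ↔ q ∈ φ.vars c ∨ q ∈ ψ.vars c := by
  cases c <;> simp [Formula.vars]

@[simp] theorem mem_vars_or : q ∈ (φ.or ψ).vars c ↔ q ∈ φ.vars c ∨ q ∈ ψ.vars c := by
  cases c <;> simp [Formula.vars]

@[simp] theorem mem_vars_imp : q ∈ (φ.imp ψ).vars c ↔ q ∈ φ.vars c.dual ∨ q ∈ ψ.vars c := by
  cases c <;> simp [Formula.vars]

@[simp] theorem mem_vars_box : q ∈ φ.box.vars c ↔ q ∈ φ.vars c := by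
  cases c <;> simp [Formula.vars]

@[simp] theorem mem_multisetVars_zero :
    q ∈ multisetVars c (0 : Multiset (Formula α)) ↔ False := by
  simp [multisetVars]

@[simp] theorem mem_multisetVars_singleton : q ∈ multisetVars c {φ} ↔ q ∈ φ.vars c := by
  simp [multisetVars]

@[simp] theorem mem_multisetVars_cons :
    q ∈ multisetVars c (φ ::ₘ Γ) ↔ q ∈ φ.vars c ∨ q ∈ multisetVars c Γ := by
  simp [multisetVars]

@[simp] theorem Sequent.mem_vars_mk :
    q ∈ Sequent.vars c ⟨Γ, Δ⟩ ↔ q ∈ multisetVars c.dual Γ ∨ q ∈ multisetVars c Δ :=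
  Iff.rfl

end vars

/-! ### Finite conjunctions and disjunctions -/

/-- The conjunction of a list of formulas. -/
def conj : List (Formula α) → Formula α
  | [] => .imp .bot .bot
  | φ :: l => .and φ (conj l)

/-- The disjunction of a list of formulas. -/
def disj : List (Formula α) → Formula α
  | [] => .bot
  | φ :: l => .or φ (disj l)

theorem force_conj {M : Model α} {w : M.World} {l : List (Formula α)} :
    M.Force w (conj l) ↔ ∀ φ ∈ l, M.Force w φ := by
  induction l with
  | nil => simp [conj, Model.Force]
  | cons φ l ih => simp [conj, Model.Force, ih]

theorem force_disj {M : Model α} {w : M.World} {l : List (Formula α)} :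
    M.Force w (disj l) ↔ ∃ φ ∈ l, M.Force w φ := by
  induction l with
  | nil => simp [disj, Model.Force]
  | cons φ l ih => simp [disj, Model.Force, ih]

theorem mem_vars_conj {q : α} {c : Polarity} {l : List (Formula α)} :
    q ∈ (conj l).vars c ↔ ∃ φ ∈ l, q ∈ φ.vars c := by
  induction l with
  | nil => simp [conj]
  | cons φ l ih => simp [conj, ih]

theorem mem_vars_disj {q : α} {c : Polarity} {l : List (Formula α)} :
    q ∈ (disj l).vars c ↔ ∃ φ ∈ l, q ∈ φ.vars c := by
  induction l with
  | nil => simp [disj]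
  | cons φ l ih => simp [disj, ih]

theorem Valid.of_subset {Γ Θ Δ : Multiset (Formula α)} (h : Valid ⟨Γ, Δ⟩)
    (hΓ : ∀ φ ∈ Γ, φ ∈ Θ) : Valid ⟨Θ, Δ⟩ :=
  h.trans fun φ hφ => .of_mem (hΓ φ hφ)

theorem Valid.replace {C Δ : Multiset (Formula α)} {e e' : Formula α}
    (h : Valid ⟨C + {e'}, Δ⟩) (he : Valid ⟨{e}, {e'}⟩) : Valid ⟨C + {e}, Δ⟩ := by
  refine h.trans fun φ hφ => ?_
  simp only [Multiset.mem_add, Multiset.mem_singleton] at hφ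
  rcases hφ with hφ | rfl
  · exact .of_mem (by simp [hφ])
  · exact he.of_subset (by simp)

theorem Valid.force_of_add {C : Multiset (Formula α)} {e f : Formula α}
    (h : Valid ⟨C + {e}, {f}⟩) {M : Model α} {w : M.World} (hC : ∀ φ ∈ C, M.Force w φ)
    (he : M.Force w e) : M.Force w f := by
  simpa using h M w (by
    intro φ hφ
    simp only [Multiset.mem_add, Multiset.mem_singleton] at hφ
    rcases hφ with hφ | rfl
    exacts [hC φ hφ, he])

theorem Valid.of_force_add {C : Multiset (Formula α)} {e f : Formula α}
    (h : ∀ (M : Model α) (w : M.World), (∀ φ ∈ C, M.Force w φ) → M.Force w e → M.Force w f) :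
    Valid ⟨C + {e}, {f}⟩ :=
  fun M w hw => ⟨f, Multiset.mem_singleton_self f,
    h M w (fun φ hφ => hw φ (by simp [hφ])) (hw e (by simp))⟩

/-! ### Specifications of the interpolants -/

/-- `e` is an existential interpolant of `Γ` at the atom `p` and the polarity `d`. -/
structure IsExistsInterpolant (d : Polarity) (p : α) (Γ : Multiset (Formula α))
    (e : Formula α) : Prop where
  vars : ∀ c q, q ∈ e.vars c → q ∈ multisetVars c Γ ∧ ¬ (q = p ∧ c = d)
  valid : Valid ⟨Γ, {e}⟩
  -- The hypothesis is a derivation, to be inducted on; the conclusion is semantic, so that cuts are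
  -- free.
  strong : ∀ C D, p ∉ multisetVars d.dual C → p ∉ multisetVars d D →
    Derivable ⟨Γ + C, D⟩ → Valid ⟨C + {e}, D⟩

/-- `a` is a universal interpolant of `S` at the atom `p` and the polarity `d`. -/
structure IsForallInterpolant (d : Polarity) (p : α) (S : Sequent α) (a : Formula α) :
    Prop where
  vars : ∀ c q, q ∈ a.vars c → q ∈ S.vars c ∧ ¬ (q = p ∧ c = d)
  valid : Valid ⟨a ::ₘ S.ant, S.suc⟩
  -- An arbitrary existential interpolant is allowed, since that of `S.ant` need not have smaller
  -- weight than `S` and so is not available in the recursion.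
  weak : ∀ e C, IsExistsInterpolant d.dual p S.ant e → p ∉ multisetVars d C →
    Derivable ⟨S.ant + C, S.suc⟩ → Valid ⟨C + {e}, {a}⟩

namespace IsExistsInterpolant

variable {d : Polarity} {p : α} {Γ : Multiset (Formula α)} {e : Formula α}

theorem notMem (h : IsExistsInterpolant d p Γ e) : p ∉ e.vars d :=
  fun hp => (h.vars d p hp).2 ⟨rfl, rfl⟩

/-- Completeness turns validity into a derivation, to which `strong` applies. This is how
interpolants of different multisets are compared. -/
theorem force_of_cons (h : IsExistsInterpolant d p Γ e) {φ ψ : Formula α}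
    (hφ : p ∉ φ.vars d.dual) (hψ : p ∉ ψ.vars d) (hv : Valid ⟨φ ::ₘ Γ, {ψ}⟩)
    {M : Model α} {w : M.World} (he : M.Force w e) (hw : M.Force w φ) : M.Force w ψ := by
  refine (h.strong {φ} {ψ} (by simpa) (by simpa) (Valid.derivable ?_ ?_)).force_of_add
    (by simpa) he
  · simp [Sequent.IsSingleConclusion]
  · rwa [add_comm, Multiset.singleton_add]

theorem force_of (h : IsExistsInterpolant d p Γ e) {ψ : Formula α}
    (hψ : p ∉ ψ.vars d) (hv : Valid ⟨Γ, {ψ}⟩) {M : Model α} {w : M.World}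
    (he : M.Force w e) : M.Force w ψ := by
  refine (h.strong 0 {ψ} (by simp) (by simpa) (Valid.derivable ?_ ?_)).force_of_add
    (by simp) he
  · simp [Sequent.IsSingleConclusion]
  · rwa [add_zero]

end IsExistsInterpolant

theorem IsForallInterpolant.notMem {d : Polarity} {p : α} {S : Sequent α} {a : Formula α}
    (h : IsForallInterpolant d p S a) : p ∉ a.vars d :=
  fun hp => (h.vars d p hp).2 ⟨rfl, rfl⟩

/-! ### The conjuncts and disjuncts of the interpolants -/

section clauses

variable (E : Polarity → Multiset (Formula α) → Formula α)
  (A : Polarity → Sequent α → Formula α) (d : Polarity) (p : α)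

open Classical in
/-- The conjuncts of the existential interpolant of `a.imp ψ ::ₘ Γ` contributed by `a.imp ψ`. -/
noncomputable def impConjuncts (Γ : Multiset (Formula α)) (a ψ : Formula α) :
    List (Formula α) :=
  -- Covers `atomImpL` and `boxImpL` when both principal formulas belong to the multiset.
  (if Valid ⟨Γ, {a}⟩ then [E d (ψ ::ₘ Γ)] else []) ++
  match a with
  | .atom q => if q = p ∧ d = .neg then [] else [.imp (.atom q) (E d (ψ ::ₘ Γ))]
  | .bot => []
  | .and a b => [E d (a.imp (b.imp ψ) ::ₘ Γ)]
  | .or a b => [E d (a.imp ψ ::ₘ b.imp ψ ::ₘ Γ)]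
  -- The left premise of `impImpL` takes its succedent from the principal formula, so a universal
  -- interpolant is needed; it stands in negative position, hence the dual polarity.
  | .imp a b => [.imp (.imp (E d (b.imp ψ ::ₘ Γ)) (A d.dual ⟨b.imp ψ ::ₘ Γ, {a.imp b}⟩))
      (E d (ψ ::ₘ Γ))]
  | .box a => [.imp (.box (A d.dual ⟨0, {a}⟩)) (E d (ψ ::ₘ Γ))]

open Classical in
/-- The conjuncts of the existential interpolant of `φ ::ₘ Γ` contributed by `φ`. -/
noncomputable def conjuncts (Γ : Multiset (Formula α)) (φ : Formula α) : List (Formula α) :=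
  E d Γ :: match φ with
  | .atom q => if q = p ∧ d = .pos then [] else [.atom q]
  | .bot => [.bot]
  | .and a b => [E d (a ::ₘ b ::ₘ Γ)]
  | .or a b => [.or (E d (a ::ₘ Γ)) (E d (b ::ₘ Γ))]
  | .imp a ψ => impConjuncts E A d p Γ a ψ
  | .box a => [.box (E d {a})]

open Classical in
/-- The disjuncts of the universal interpolant of `⟨a.imp ψ ::ₘ Γ, Δ⟩` contributed
by `a.imp ψ`. -/
noncomputable def impDisjuncts (Γ Δ : Multiset (Formula α)) (a ψ : Formula α) :
    List (Formula α) :=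
  (if Valid ⟨Γ, {a}⟩ then [A d ⟨ψ ::ₘ Γ, Δ⟩] else []) ++
  match a with
  | .atom q => if q = p ∧ d = .pos then [] else [.and (.atom q) (A d ⟨ψ ::ₘ Γ, Δ⟩)]
  | .bot => []
  | .and a b => [A d ⟨a.imp (b.imp ψ) ::ₘ Γ, Δ⟩]
  | .or a b => [A d ⟨a.imp ψ ::ₘ b.imp ψ ::ₘ Γ, Δ⟩]
  | .imp a b =>
      [.and (.imp (E d.dual (b.imp ψ ::ₘ Γ)) (A d ⟨b.imp ψ ::ₘ Γ, {a.imp b}⟩))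
        (A d ⟨ψ ::ₘ Γ, Δ⟩)]
  | .box a => [.and (.box (A d ⟨0, {a}⟩)) (A d ⟨ψ ::ₘ Γ, Δ⟩)]

/-- The disjuncts of the universal interpolant of `⟨φ ::ₘ Γ, Δ⟩` contributed by `φ`. -/
noncomputable def leftDisjuncts (Γ Δ : Multiset (Formula α)) (φ : Formula α) :
    List (Formula α) :=
  A d ⟨Γ, Δ⟩ :: match φ with
  -- Atoms, `⊥` and boxes need no clause of their own: a sequent closed by them without the context
  -- is valid and gets the disjunct `⊤`, while their effect on the context passes through the
  -- existential interpolant.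
  | .atom _ => []
  | .bot => []
  | .and a b => [A d ⟨a ::ₘ b ::ₘ Γ, Δ⟩]
  | .or a b => [.and (.imp (E d.dual (a ::ₘ Γ)) (A d ⟨a ::ₘ Γ, Δ⟩))
      (.imp (E d.dual (b ::ₘ Γ)) (A d ⟨b ::ₘ Γ, Δ⟩))]
  | .imp a ψ => impDisjuncts E A d p Γ Δ a ψ
  | .box _ => []

open Classical in
/-- The disjuncts of the universal interpolant of `⟨Γ, δ ::ₘ Δ⟩` contributed by `δ`. -/
noncomputable def rightDisjuncts (Γ : Multiset (Formula α)) (δ : Formula α) :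
    List (Formula α) :=
  match δ with
  | .atom q => if q = p ∧ d = .pos then [] else [.atom q]
  | .bot => []
  | .and a b => [.and (A d ⟨Γ, {a}⟩) (A d ⟨Γ, {b}⟩)]
  | .or a b => [.or (A d ⟨Γ, {a}⟩) (A d ⟨Γ, {b}⟩)]
  | .imp a b => [.imp (E d.dual (a ::ₘ Γ)) (A d ⟨a ::ₘ Γ, {b}⟩)]
  | .box a => [.box (A d ⟨0, {a}⟩)]

end clauses

/-! ### Correctness of the clauses and the inductions on derivations -/

section step

variable {E : Polarity → Multiset (Formula α) → Formula α}
  {A : Polarity → Sequent α → Formula α} {p : α} {n : ℕ}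

theorem impConjuncts_spec
    (hE : ∀ d Γ, multisetWeight Γ < n → IsExistsInterpolant d p Γ (E d Γ))
    (hA : ∀ d S, S.weight < n → IsForallInterpolant d p S (A d S))
    {d : Polarity} {Γ : Multiset (Formula α)} {a ψ : Formula α}
    (hn : multisetWeight (a.imp ψ ::ₘ Γ) = n) {e : Formula α}
    (he : e ∈ impConjuncts E A d p Γ a ψ) :
    Valid ⟨a.imp ψ ::ₘ Γ, {e}⟩ ∧
      ∀ c q, q ∈ e.vars c → q ∈ multisetVars c (a.imp ψ ::ₘ Γ) ∧ ¬ (q = p ∧ c = d) := by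
  rw [multisetWeight_cons] at hn
  have h := hE d (ψ ::ₘ Γ) (by
    have := a.weight_imp_lt ψ
    simp only [multisetWeight_cons]; omega)
  have hv := fun c q hq => (h.vars c q hq).1
  have hv' := fun c q hq => (h.vars c q hq).2
  simp only [impConjuncts, List.mem_append] at he
  rcases he with he | he
  · split_ifs at he with ha
    · simp only [List.mem_singleton] at he
      subst he
      refine ⟨.impL ha.weakL h.valid, fun c q hq => ⟨?_, hv' c q hq⟩⟩
      have := hv c q hq
      simp only [mem_vars_imp, mem_multisetVars_cons] at this ⊢
      tauto
    · simp at he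
  rcases a with r | _ | ⟨a, b⟩ | ⟨a, b⟩ | ⟨a, b⟩ | a
  · simp only at he
    split_ifs at he with hr
    · simp at he
    · simp only [List.mem_singleton] at he
      subst he
      constructor
      · refine .impR ?_
        rw [Multiset.cons_swap]
        refine .impL (.of_mem (by simp)) ?_
        rw [Multiset.cons_swap]
        exact h.valid.weakL
      · intro c q hq
        have hv := hv c q
        have hv' := hv' c q
        clear hE hA h
        simp only [mem_vars_imp, mem_vars_atom, mem_multisetVars_cons] at hv hq ⊢
        cases c <;> cases d <;> simp [Polarity.dual] at * <;> grind
  · simp at he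
  · simp only [List.mem_singleton] at he
    subst he
    have h := hE d (a.imp (b.imp ψ) ::ₘ Γ) (by
      have := a.weight_and_imp_lt b ψ
      simp only [multisetWeight_cons]; omega)
    refine ⟨.andImpL h.valid, fun c q hq => ⟨?_, (h.vars c q hq).2⟩⟩
    have := (h.vars c q hq).1
    simp only [mem_vars_imp, mem_vars_and, mem_multisetVars_cons] at this ⊢
    tauto
  · simp only [List.mem_singleton] at he
    subst he
    have h := hE d (a.imp ψ ::ₘ b.imp ψ ::ₘ Γ) (by
      have := a.weight_or_imp_lt b ψ
      simp only [multisetWeight_cons]; omega)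
    refine ⟨.orImpL h.valid, fun c q hq => ⟨?_, (h.vars c q hq).2⟩⟩
    have := (h.vars c q hq).1
    simp only [mem_vars_imp, mem_vars_or, mem_multisetVars_cons] at this ⊢
    tauto
  · simp only [List.mem_singleton] at he
    subst he
    have hlt := a.weight_imp_imp_lt b ψ
    have h₁ := hE d (b.imp ψ ::ₘ Γ) (by simp only [multisetWeight_cons]; omega)
    have h₂ := hA d.dual ⟨b.imp ψ ::ₘ Γ, {a.imp b}⟩ (by
      simp only [Sequent.weight, multisetWeight_cons, multisetWeight_singleton]; omega)
    constructor
    · refine .impR ?_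
      rw [Multiset.cons_swap]
      refine .impImpL (fun M w hw => h₂.valid M w ?_)
        (h.valid.of_subset (by simp +contextual))
      simp only [Multiset.forall_mem_cons] at hw ⊢
      -- The antecedent `b → ψ, Γ` forces its `E`, so the assumed implication yields `A`, and `A`
      -- yields `a → b`.
      refine ⟨hw.2.1.mp ?_, hw.1, hw.2.2⟩
      simpa using h₁.valid M w (by simpa using ⟨hw.1, hw.2.2⟩)
    · intro c q hq
      have h₁ := h₁.vars c q
      have h₂ := h₂.vars c.dual q
      have h := h.vars c q
      simp only [mem_vars_imp, mem_multisetVars_cons, Sequent.mem_vars_mk,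
        mem_multisetVars_singleton, Polarity.dual_dual, Polarity.dual_inj] at h₁ h₂ h hq ⊢
      clear hE hA hv hv'
      grind
  · simp only [List.mem_singleton] at he
    subst he
    have h₂ := hA d.dual ⟨0, {a}⟩ (by
      have := a.weight_box_lt
      have := a.box.weight_imp_lt ψ
      simp only [Sequent.weight, multisetWeight_zero, multisetWeight_singleton]; omega)
    constructor
    · refine .impR ?_
      rw [Multiset.cons_swap]
      refine .impL ((Valid.boxM h₂.valid).of_subset (by simp))
        (h.valid.of_subset (by simp +contextual))
    · intro c q hq
      have h₂ := h₂.vars c.dual q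
      have h := h.vars c q
      simp only [mem_vars_imp, mem_vars_box, mem_multisetVars_cons, Sequent.mem_vars_mk,
        mem_multisetVars_singleton, Polarity.dual_inj, mem_multisetVars_zero] at h₂ h hq ⊢
      clear hE hA hv hv'
      grind

theorem conjuncts_spec
    (hE : ∀ d Γ, multisetWeight Γ < n → IsExistsInterpolant d p Γ (E d Γ))
    (hA : ∀ d S, S.weight < n → IsForallInterpolant d p S (A d S))
    {d : Polarity} {Γ : Multiset (Formula α)} {φ : Formula α}
    (hn : multisetWeight (φ ::ₘ Γ) = n) {e : Formula α}
    (he : e ∈ conjuncts E A d p Γ φ) :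
    Valid ⟨φ ::ₘ Γ, {e}⟩ ∧
      ∀ c q, q ∈ e.vars c → q ∈ multisetVars c (φ ::ₘ Γ) ∧ ¬ (q = p ∧ c = d) := by
  rw [multisetWeight_cons] at hn
  have hφ := φ.two_le_weight
  simp only [conjuncts, List.mem_cons] at he
  rcases he with rfl | he
  · have h := hE d Γ (by omega)
    exact ⟨h.valid.weakL, fun c q hq => ⟨by simp [(h.vars c q hq).1], (h.vars c q hq).2⟩⟩
  rcases φ with q | _ | ⟨a, b⟩ | ⟨a, b⟩ | ⟨a, ψ⟩ | a
  · simp only at he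
    split_ifs at he with hq
    · simp at he
    · simp only [List.mem_singleton] at he
      subst he
      refine ⟨.of_mem (by simp), fun c r hr => ⟨by simp [hr], ?_⟩⟩
      simp only [mem_vars_atom] at hr
      grind
  · simp only [List.mem_singleton] at he
    subst he
    exact ⟨.botL, by simp⟩
  · simp only [List.mem_singleton] at he
    subst he
    have h := hE d (a ::ₘ b ::ₘ Γ) (by
      have := a.weight_and_lt b
      simp only [multisetWeight_cons]; omega)
    refine ⟨.andL h.valid, fun c q hq => ⟨?_, (h.vars c q hq).2⟩⟩
    simpa [or_assoc] using (h.vars c q hq).1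
  · simp only [List.mem_singleton] at he
    subst he
    have := a.weight_or_lt b
    have h₁ := hE d (a ::ₘ Γ) (by simp only [multisetWeight_cons]; omega)
    have h₂ := hE d (b ::ₘ Γ) (by simp only [multisetWeight_cons]; omega)
    refine ⟨.orL (.orR₀ h₁.valid) (.orR₁ h₂.valid), fun c q hq => ?_⟩
    have h₁ := h₁.vars c q
    have h₂ := h₂.vars c q
    simp only [mem_vars_or, mem_multisetVars_cons] at h₁ h₂ hq ⊢
    tauto
  · exact impConjuncts_spec hE hA (by rwa [multisetWeight_cons]) he
  · simp only [List.mem_singleton] at he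
    subst he
    have h := hE d {a} (by
      have := a.weight_box_lt
      simp only [multisetWeight_singleton]; omega)
    refine ⟨(Valid.boxM h.valid).of_subset (by simp), fun c q hq => ⟨?_, (h.vars c q ?_).2⟩⟩
    · have := (h.vars c q (by simpa using hq)).1
      simp only [mem_multisetVars_singleton, mem_multisetVars_cons, mem_vars_box] at this ⊢
      tauto
    · simpa using hq

theorem impDisjuncts_spec
    (hE : ∀ d Γ, multisetWeight Γ < n → IsExistsInterpolant d p Γ (E d Γ))
    (hA : ∀ d S, S.weight < n → IsForallInterpolant d p S (A d S))
    {d : Polarity} {Γ Δ : Multiset (Formula α)} {a ψ : Formula α}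
    (hn : Sequent.weight ⟨a.imp ψ ::ₘ Γ, Δ⟩ = n) {e : Formula α}
    (he : e ∈ impDisjuncts E A d p Γ Δ a ψ) :
    Valid ⟨e ::ₘ a.imp ψ ::ₘ Γ, Δ⟩ ∧
      ∀ c q, q ∈ e.vars c → q ∈ Sequent.vars c ⟨a.imp ψ ::ₘ Γ, Δ⟩ ∧ ¬ (q = p ∧ c = d) := by
  simp only [Sequent.weight, multisetWeight_cons] at hn
  have h := hA d ⟨ψ ::ₘ Γ, Δ⟩ (by
    have := a.weight_imp_lt ψ
    simp only [Sequent.weight, multisetWeight_cons]; omega)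
  have hval : Valid ⟨ψ ::ₘ A d ⟨ψ ::ₘ Γ, Δ⟩ ::ₘ Γ, Δ⟩ := h.valid.of_subset (by simp; grind)
  have hv := h.vars
  simp only [impDisjuncts, List.mem_append] at he
  rcases he with he | he
  · split_ifs at he with ha
    · simp only [List.mem_singleton] at he
      subst he
      refine ⟨?_, fun c q hq => ?_⟩
      · rw [Multiset.cons_swap]
        exact .impL ha.weakL.weakL hval
      · have hv := hv c q
        simp only [mem_vars_imp, mem_multisetVars_cons, Sequent.mem_vars_mk] at hv ⊢
        tauto
    · simp at he
  rcases a with r | _ | ⟨a, b⟩ | ⟨a, b⟩ | ⟨a, b⟩ | a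
  · simp only at he
    split_ifs at he with hr
    · simp at he
    · simp only [List.mem_singleton] at he
      subst he
      constructor
      · refine .andL ?_
        rw [Multiset.cons_swap (A d _), Multiset.cons_swap]
        refine .impL (.of_mem (by simp)) (hval.of_subset (by simp; grind))
      · intro c q hq
        have hv := hv c q
        clear hE hA h hval
        simp only [mem_vars_imp, mem_vars_atom, mem_vars_and, mem_multisetVars_cons,
          Sequent.mem_vars_mk, Polarity.dual_dual] at hv hq ⊢
        grind
  · simp at he
  · simp only [List.mem_singleton] at he
    subst he
    have h := hA d ⟨a.imp (b.imp ψ) ::ₘ Γ, Δ⟩ (by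
      have := a.weight_and_imp_lt b ψ
      simp only [Sequent.weight, multisetWeight_cons]; omega)
    constructor
    · rw [Multiset.cons_swap]
      refine .andImpL ?_
      rw [Multiset.cons_swap]
      exact h.valid
    · intro c q hq
      have hv := h.vars c q
      clear hE hA h hval
      simp only [mem_vars_imp, mem_vars_and, mem_multisetVars_cons,
        Sequent.mem_vars_mk, Polarity.dual_dual] at hv ⊢
      grind
  · simp only [List.mem_singleton] at he
    subst he
    have h := hA d ⟨a.imp ψ ::ₘ b.imp ψ ::ₘ Γ, Δ⟩ (by
      have := a.weight_or_imp_lt b ψ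
      simp only [Sequent.weight, multisetWeight_cons]; omega)
    constructor
    · rw [Multiset.cons_swap]
      exact .orImpL (h.valid.of_subset (by simp; grind))
    · intro c q hq
      have hv := h.vars c q
      clear hE hA h hval
      simp only [mem_vars_imp, mem_vars_or, mem_multisetVars_cons,
        Sequent.mem_vars_mk, Polarity.dual_dual] at hv ⊢
      grind
  · simp only [List.mem_singleton] at he
    subst he
    have hlt := a.weight_imp_imp_lt b ψ
    have h₁ := hE d.dual (b.imp ψ ::ₘ Γ) (by simp only [multisetWeight_cons]; omega)
    have h₂ := hA d ⟨b.imp ψ ::ₘ Γ, {a.imp b}⟩ (by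
      simp only [Sequent.weight, multisetWeight_cons, multisetWeight_singleton]; omega)
    constructor
    · refine .andL ?_
      rw [Multiset.cons_swap (A d _), Multiset.cons_swap]
      refine .impImpL (fun M w hw => h₂.valid M w ?_) (hval.of_subset (by simp; grind))
      simp only [Multiset.forall_mem_cons] at hw ⊢
      refine ⟨hw.2.1.mp ?_, hw.1, hw.2.2.2⟩
      simpa using h₁.valid M w (by simpa using ⟨hw.1, hw.2.2.2⟩)
    · intro c q hq
      have h₁ := h₁.vars c.dual q
      have h₂ := h₂.vars c q
      have hv := hv c q
      clear hE hA h hval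
      simp only [mem_vars_imp, mem_vars_and, mem_multisetVars_cons, Sequent.mem_vars_mk,
        mem_multisetVars_singleton, Polarity.dual_dual, Polarity.dual_inj] at h₁ h₂ hv hq ⊢
      grind
  · simp only [List.mem_singleton] at he
    subst he
    have h₂ := hA d ⟨0, {a}⟩ (by
      have := a.weight_box_lt
      have := a.box.weight_imp_lt ψ
      simp only [Sequent.weight, multisetWeight_zero, multisetWeight_singleton]; omega)
    constructor
    · refine .andL ?_
      rw [Multiset.cons_swap (A d _), Multiset.cons_swap]
      exact .impL ((Valid.boxM h₂.valid).of_subset (by simp))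
        (hval.of_subset (by simp; grind))
    · intro c q hq
      have h₂ := h₂.vars c q
      have hv := hv c q
      clear hE hA h hval
      simp only [mem_vars_imp, mem_vars_box, mem_vars_and, mem_multisetVars_cons,
        Sequent.mem_vars_mk, mem_multisetVars_singleton, Polarity.dual_dual,
        mem_multisetVars_zero] at h₂ hv hq ⊢
      grind

theorem leftDisjuncts_spec
    (hE : ∀ d Γ, multisetWeight Γ < n → IsExistsInterpolant d p Γ (E d Γ))
    (hA : ∀ d S, S.weight < n → IsForallInterpolant d p S (A d S))
    {d : Polarity} {Γ Δ : Multiset (Formula α)} {φ : Formula α}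
    (hn : Sequent.weight ⟨φ ::ₘ Γ, Δ⟩ = n) {e : Formula α}
    (he : e ∈ leftDisjuncts E A d p Γ Δ φ) :
    Valid ⟨e ::ₘ φ ::ₘ Γ, Δ⟩ ∧
      ∀ c q, q ∈ e.vars c → q ∈ Sequent.vars c ⟨φ ::ₘ Γ, Δ⟩ ∧ ¬ (q = p ∧ c = d) := by
  have hn' := hn
  simp only [Sequent.weight, multisetWeight_cons] at hn'
  have hφ := φ.two_le_weight
  simp only [leftDisjuncts, List.mem_cons] at he
  rcases he with rfl | he
  · have h := hA d ⟨Γ, Δ⟩ (by simp only [Sequent.weight]; omega)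
    refine ⟨by rw [Multiset.cons_swap]; exact h.valid.weakL, fun c q hq => ?_⟩
    have hv := h.vars c q
    simp only [mem_multisetVars_cons, Sequent.mem_vars_mk] at hv ⊢
    tauto
  rcases φ with q | _ | ⟨a, b⟩ | ⟨a, b⟩ | ⟨a, ψ⟩ | a
  · simp at he
  · simp at he
  · simp only [List.mem_singleton] at he
    subst he
    have h := hA d ⟨a ::ₘ b ::ₘ Γ, Δ⟩ (by
      have := a.weight_and_lt b
      simp only [Sequent.weight, multisetWeight_cons]; omega)
    constructor
    · rw [Multiset.cons_swap]
      exact .andL (h.valid.of_subset (by simp; grind))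
    · intro c q hq
      have hv := h.vars c q
      simp only [mem_vars_and, mem_multisetVars_cons, Sequent.mem_vars_mk] at hv ⊢
      tauto
  · simp only [List.mem_singleton] at he
    subst he
    have := a.weight_or_lt b
    have h₁ := hE d.dual (a ::ₘ Γ) (by simp only [multisetWeight_cons]; omega)
    have h₂ := hE d.dual (b ::ₘ Γ) (by simp only [multisetWeight_cons]; omega)
    have h₃ := hA d ⟨a ::ₘ Γ, Δ⟩ (by simp only [Sequent.weight, multisetWeight_cons]; omega)
    have h₄ := hA d ⟨b ::ₘ Γ, Δ⟩ (by simp only [Sequent.weight, multisetWeight_cons]; omega)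
    constructor
    · rw [Multiset.cons_swap]
      refine .orL (fun M w hw => h₃.valid M w ?_) (fun M w hw => h₄.valid M w ?_)
      all_goals simp only [Multiset.forall_mem_cons] at hw ⊢
      · refine ⟨hw.2.1.1.mp ?_, hw.1, hw.2.2⟩
        simpa using h₁.valid M w (by simpa using ⟨hw.1, hw.2.2⟩)
      · refine ⟨hw.2.1.2.mp ?_, hw.1, hw.2.2⟩
        simpa using h₂.valid M w (by simpa using ⟨hw.1, hw.2.2⟩)
    · intro c q hq
      have h₁ := h₁.vars c.dual q
      have h₂ := h₂.vars c.dual q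
      have h₃ := h₃.vars c q
      have h₄ := h₄.vars c q
      clear hE hA
      simp only [mem_vars_imp, mem_vars_or, mem_vars_and, mem_multisetVars_cons,
        Sequent.mem_vars_mk, Polarity.dual_inj] at h₁ h₂ h₃ h₄ hq ⊢
      grind
  · exact impDisjuncts_spec hE hA hn he
  · simp at he

theorem rightDisjuncts_spec
    (hE : ∀ d Γ, multisetWeight Γ < n → IsExistsInterpolant d p Γ (E d Γ))
    (hA : ∀ d S, S.weight < n → IsForallInterpolant d p S (A d S))
    {d : Polarity} {Γ Δ : Multiset (Formula α)} {δ : Formula α}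
    (hn : Sequent.weight ⟨Γ, δ ::ₘ Δ⟩ = n) {e : Formula α}
    (he : e ∈ rightDisjuncts E A d p Γ δ) :
    Valid ⟨e ::ₘ Γ, {δ}⟩ ∧
      ∀ c q, q ∈ e.vars c → q ∈ Sequent.vars c ⟨Γ, {δ}⟩ ∧ ¬ (q = p ∧ c = d) := by
  simp only [Sequent.weight, multisetWeight_cons] at hn
  rcases δ with q | _ | ⟨a, b⟩ | ⟨a, b⟩ | ⟨a, b⟩ | a
  · simp only [rightDisjuncts] at he
    split_ifs at he with hq
    · simp at he
    · simp only [List.mem_singleton] at he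
      subst he
      refine ⟨.of_mem (by simp), fun c r hr => ⟨by simp [hr], ?_⟩⟩
      simp only [mem_vars_atom] at hr
      grind
  · simp [rightDisjuncts] at he
  · simp only [rightDisjuncts, List.mem_singleton] at he
    subst he
    have := a.weight_and_lt b
    have h₁ := hA d ⟨Γ, {a}⟩ (by simp only [Sequent.weight, multisetWeight_singleton]; omega)
    have h₂ := hA d ⟨Γ, {b}⟩ (by simp only [Sequent.weight, multisetWeight_singleton]; omega)
    constructor
    · exact .andL (.andR (h₁.valid.of_subset (by simp; grind)) h₂.valid.weakL)
    · intro c q hq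
      have h₁ := h₁.vars c q
      have h₂ := h₂.vars c q
      clear hE hA
      simp only [mem_vars_and, mem_multisetVars_singleton, Sequent.mem_vars_mk] at h₁ h₂ hq ⊢
      grind
  · simp only [rightDisjuncts, List.mem_singleton] at he
    subst he
    have := a.weight_or_lt b
    have h₁ := hA d ⟨Γ, {a}⟩ (by simp only [Sequent.weight, multisetWeight_singleton]; omega)
    have h₂ := hA d ⟨Γ, {b}⟩ (by simp only [Sequent.weight, multisetWeight_singleton]; omega)
    constructor
    · exact .orL (.orR₀ h₁.valid) (.orR₁ h₂.valid)
    · intro c q hq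
      have h₁ := h₁.vars c q
      have h₂ := h₂.vars c q
      clear hE hA
      simp only [mem_vars_or, mem_multisetVars_singleton, Sequent.mem_vars_mk] at h₁ h₂ hq ⊢
      grind
  · simp only [rightDisjuncts, List.mem_singleton] at he
    subst he
    have := a.weight_imp_lt b
    have h₁ := hE d.dual (a ::ₘ Γ) (by simp only [multisetWeight_cons]; omega)
    have h₂ := hA d ⟨a ::ₘ Γ, {b}⟩ (by
      simp only [Sequent.weight, multisetWeight_cons, multisetWeight_singleton]; omega)
    constructor
    · refine .impR fun M w hw => h₂.valid M w ?_
      simp only [Multiset.forall_mem_cons] at hw ⊢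
      refine ⟨hw.2.1.mp ?_, hw.1, hw.2.2⟩
      simpa using h₁.valid M w (by simpa using ⟨hw.1, hw.2.2⟩)
    · intro c q hq
      have h₁ := h₁.vars c.dual q
      have h₂ := h₂.vars c q
      clear hE hA
      simp only [mem_vars_imp, mem_multisetVars_singleton, mem_multisetVars_cons,
        Sequent.mem_vars_mk, Polarity.dual_inj] at h₁ h₂ hq ⊢
      grind
  · simp only [rightDisjuncts, List.mem_singleton] at he
    subst he
    have h := hA d ⟨0, {a}⟩ (by
      have := a.weight_box_lt
      simp only [Sequent.weight, multisetWeight_zero, multisetWeight_singleton]; omega)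
    constructor
    · exact (Valid.boxM h.valid).of_subset (by simp)
    · intro c q hq
      have hv := h.vars c q
      clear hE hA
      simp only [mem_vars_box, mem_multisetVars_singleton, mem_multisetVars_zero,
        Sequent.mem_vars_mk] at hv hq ⊢
      grind

/-- A formula that implies all conjuncts has the universal property of the existential
interpolant. -/
theorem exists_strong {d : Polarity} {Γ : Multiset (Formula α)}
    (hE : ∀ d Γ', multisetWeight Γ' < n → IsExistsInterpolant d p Γ' (E d Γ'))
    (hA : ∀ d S, S.weight < n → IsForallInterpolant d p S (A d S))
    (hn : multisetWeight Γ = n) {e : Formula α}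
    (he : ∀ φ Γ', Γ = φ ::ₘ Γ' → ∀ c ∈ conjuncts E A d p Γ' φ, Valid ⟨{e}, {c}⟩)
    {C D : Multiset (Formula α)} (hC : p ∉ multisetVars d.dual C) (hD : p ∉ multisetVars d D)
    (h : Derivable ⟨Γ + C, D⟩) : Valid ⟨C + {e}, D⟩ := by
  generalize hS : (⟨Γ + C, D⟩ : Sequent α) = S at h
  have hlt : ∀ {a ψ Γ'}, Γ = .imp a ψ ::ₘ Γ' → multisetWeight (ψ ::ₘ Γ') < n := by
    rintro a ψ Γ' rfl
    have := a.weight_imp_lt ψ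
    simp only [multisetWeight_cons] at hn ⊢; omega
  -- A box rule crossing from `Γ` to the context: `E {φ}` entails the `p`-free `ψ`, so the conjunct
  -- `□ E {φ}` gives `□ψ`.
  have hbox : ∀ {φ ψ Γ'}, Γ = .box φ ::ₘ Γ' → Derivable ⟨{φ}, {ψ}⟩ → p ∉ ψ.vars d →
      Valid ⟨{e}, {ψ.box}⟩ := by
    rintro φ ψ Γ' rfl hd hψ M w hw
    have h := hE d {φ} (by
      have := φ.weight_box_lt
      simp only [multisetWeight_cons, multisetWeight_singleton] at hn ⊢; omega)
    exact Valid.boxM (φ := E d {φ}) (fun M w hw => ⟨ψ, by simp, h.force_of hψ hd.valid (hw (E d {φ}) (by simp))⟩) M w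
      (by simpa using he _ _ rfl (.box (E d {φ})) (by simp [conjuncts]) M w hw)
  -- `Γ` stays fixed. A left rule whose principal formula lies in the context uses the induction
  -- hypothesis, one whose principal formula lies in `Γ` uses a conjunct and the smaller
  -- interpolants.
  induction h generalizing C D with
  | ax Θ q =>
    simp only [Sequent.mk.injEq] at hS
    obtain ⟨hS, rfl⟩ := hS
    rcases cons_eq_add_split hS with ⟨Γ', rfl, rfl⟩ | ⟨C', rfl, rfl⟩
    · refine (he _ _ rfl (.atom q) ?_).of_subset (by simp)
      simp only [mem_multisetVars_singleton, mem_vars_atom] at hD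
      simp only [conjuncts]
      split_ifs with hq
      · exact (hD ⟨hq.1.symm, hq.2⟩).elim
      · simp
    · exact .of_mem (by simp)
  | botL Θ Δ hΔ =>
    simp only [Sequent.mk.injEq] at hS
    obtain ⟨hS, rfl⟩ := hS
    rcases cons_eq_add_split hS with ⟨Γ', rfl, rfl⟩ | ⟨C', rfl, rfl⟩
    · exact Valid.replace (by rw [add_comm]; exact .botL)
        (he _ _ rfl .bot (by simp [conjuncts]))
    · rw [Multiset.cons_add]; exact .botL
  | andL Θ Δ a b h ih =>
    simp only [Sequent.mk.injEq] at hS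
    obtain ⟨hS, rfl⟩ := hS
    rcases cons_eq_add_split hS with ⟨Γ', rfl, rfl⟩ | ⟨C', rfl, rfl⟩
    · refine ((hE d (a ::ₘ b ::ₘ Γ') ?_).strong C D hC hD (by simpa using h)).replace
        (he _ _ rfl _ (by simp [conjuncts]))
      have := a.weight_and_lt b
      simp only [multisetWeight_cons] at hn ⊢; omega
    · rw [Multiset.cons_add]
      refine .andL ?_
      rw [← Multiset.cons_add, ← Multiset.cons_add]
      exact ih (by simpa [or_assoc] using hC) hD (by simp)
  | andR Θ a b _ _ ih₁ ih₂ =>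
    simp only [Sequent.mk.injEq] at hS
    obtain ⟨rfl, rfl⟩ := hS
    simp only [mem_multisetVars_singleton, mem_vars_and, not_or] at hD
    exact .andR (ih₁ hC (by simpa using hD.1) rfl) (ih₂ hC (by simpa using hD.2) rfl)
  | orL Θ Δ a b h₁ h₂ ih₁ ih₂ =>
    simp only [Sequent.mk.injEq] at hS
    obtain ⟨hS, rfl⟩ := hS
    rcases cons_eq_add_split hS with ⟨Γ', rfl, rfl⟩ | ⟨C', rfl, rfl⟩
    · have := a.weight_or_lt b
      simp only [multisetWeight_cons] at hn
      have h₁ := (hE d (a ::ₘ Γ') (by simp only [multisetWeight_cons]; omega)).strong C D hC hD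
        (by simpa using h₁)
      have h₂ := (hE d (b ::ₘ Γ') (by simp only [multisetWeight_cons]; omega)).strong C D hC hD
        (by simpa using h₂)
      rw [add_comm] at h₁ h₂
      refine Valid.replace ?_ (he _ _ rfl
        (.or (E d (a ::ₘ Γ')) (E d (b ::ₘ Γ'))) (by simp [conjuncts]))
      rw [add_comm]
      exact .orL h₁ h₂
    · simp only [mem_multisetVars_cons, mem_vars_or, not_or] at hC
      rw [Multiset.cons_add]
      refine .orL ?_ ?_ <;> rw [← Multiset.cons_add]
      · exact ih₁ (by simpa using ⟨hC.1.1, hC.2⟩) hD (by simp)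
      · exact ih₂ (by simpa using ⟨hC.1.2, hC.2⟩) hD (by simp)
  | orR₀ Θ a b _ ih =>
    simp only [Sequent.mk.injEq] at hS
    obtain ⟨rfl, rfl⟩ := hS
    simp only [mem_multisetVars_singleton, mem_vars_or, not_or] at hD
    exact .orR₀ (ih hC (by simpa using hD.1) rfl)
  | orR₁ Θ a b _ ih =>
    simp only [Sequent.mk.injEq] at hS
    obtain ⟨rfl, rfl⟩ := hS
    simp only [mem_multisetVars_singleton, mem_vars_or, not_or] at hD
    exact .orR₁ (ih hC (by simpa using hD.2) rfl)
  | impR Θ a b _ ih =>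
    simp only [Sequent.mk.injEq] at hS
    obtain ⟨rfl, rfl⟩ := hS
    simp only [mem_multisetVars_singleton, mem_vars_imp, not_or] at hD
    refine .impR ?_
    rw [← Multiset.cons_add]
    exact ih (by simpa using ⟨hD.1, hC⟩) (by simpa using hD.2) (by simp)
  | atomImpL Θ Δ q ψ h ih =>
    simp only [Sequent.mk.injEq] at hS
    obtain ⟨hS, rfl⟩ := hS
    rw [Multiset.cons_swap] at hS h
    rcases cons_eq_add_split hS with ⟨Γ', rfl, hΓ⟩ | ⟨C', rfl, hC'⟩
    · rw [hΓ] at h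
      have hψ := (hE d (ψ ::ₘ Γ') (hlt rfl)).strong C D hC hD (by simpa using h)
      rcases cons_eq_add_split hΓ.symm with ⟨Γ'', rfl, -⟩ | ⟨C', rfl, -⟩
      · refine hψ.replace (he _ _ rfl _ ?_)
        rw [conjuncts, impConjuncts, if_pos (.of_mem (by simp))]
        simp
      -- The atom `q` belongs to the `p`-free context, so its clause was not suppressed.
      · have hq : ¬ (q = p ∧ d = .neg) := by
          rintro ⟨rfl, rfl⟩
          simp [Polarity.dual] at hC
        refine fun M w hw => hψ M w fun χ hχ => ?_
        simp only [Multiset.mem_add, Multiset.mem_singleton] at hχ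
        rcases hχ with hχ | rfl
        · exact hw χ (Multiset.mem_add.2 (.inl hχ))
        · have := (he _ _ rfl (.imp (.atom q) (E d (ψ ::ₘ Γ')))
            (by simp [conjuncts, impConjuncts, hq])).force (hw e (by simp))
          exact this.mp (hw _ (by simp))
    · rw [Multiset.cons_add]
      have hih := @ih (ψ ::ₘ C') D
      simp only [mem_multisetVars_cons, mem_vars_imp, not_or, Polarity.dual_dual,
        mem_vars_atom] at hC hih
      refine .impL ?_ (by
        rw [← Multiset.cons_add]
        exact hih ⟨hC.1.2, hC.2⟩ hD (by
          rw [Multiset.add_cons, ← hC', Multiset.cons_swap]))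
      rcases cons_eq_add_split hC'.symm with ⟨Γ'', rfl, -⟩ | ⟨C', rfl, -⟩
      -- Here `q` is in `Γ` and `q → ψ` in the context; freeness of the latter keeps the conjunct
      -- `q`.
      · refine (he _ _ rfl (.atom q) ?_).of_subset (by simp)
        simp only [conjuncts]
        split_ifs with hq
        · exact (hC.1.1 ⟨hq.1.symm, hq.2⟩).elim
        · simp
      · exact .of_mem (by simp)
  | andImpL Θ Δ a b ψ h ih =>
    simp only [Sequent.mk.injEq] at hS
    obtain ⟨hS, rfl⟩ := hS
    rcases cons_eq_add_split hS with ⟨Γ', rfl, rfl⟩ | ⟨C', rfl, rfl⟩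
    · refine ((hE d (a.imp (b.imp ψ) ::ₘ Γ') ?_).strong C D hC hD (by simpa using h)).replace
        (he _ _ rfl _ (by simp [conjuncts, impConjuncts]))
      have := a.weight_and_imp_lt b ψ
      simp only [multisetWeight_cons] at hn ⊢; omega
    · rw [Multiset.cons_add]
      refine .andImpL ?_
      rw [← Multiset.cons_add]
      exact ih (by simpa [or_assoc] using hC) hD (by simp)
  | orImpL Θ Δ a b ψ h ih =>
    simp only [Sequent.mk.injEq] at hS
    obtain ⟨hS, rfl⟩ := hS
    rcases cons_eq_add_split hS with ⟨Γ', rfl, rfl⟩ | ⟨C', rfl, rfl⟩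
    · refine ((hE d (a.imp ψ ::ₘ b.imp ψ ::ₘ Γ') ?_).strong C D hC hD
        (by simpa using h)).replace (he _ _ rfl _ (by simp [conjuncts, impConjuncts]))
      have := a.weight_or_imp_lt b ψ
      simp only [multisetWeight_cons] at hn ⊢; omega
    · rw [Multiset.cons_add]
      refine .orImpL ?_
      rw [← Multiset.cons_add, ← Multiset.cons_add]
      refine ih ?_ hD (by simp)
      simp only [mem_multisetVars_cons, mem_vars_imp, mem_vars_or] at hC ⊢
      tauto
  | impImpL Θ Δ a b ψ h₁ h₂ ih₁ ih₂ =>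
    simp only [Sequent.mk.injEq] at hS
    obtain ⟨hS, rfl⟩ := hS
    rcases cons_eq_add_split hS with ⟨Γ', rfl, rfl⟩ | ⟨C', rfl, rfl⟩
    · have hψ := (hE d (ψ ::ₘ Γ') (hlt rfl)).strong C D hC hD (by simpa using h₂)
      have := a.weight_imp_imp_lt b ψ
      simp only [multisetWeight_cons] at hn
      have h₂ := hE d (b.imp ψ ::ₘ Γ') (by simp only [multisetWeight_cons]; omega)
      -- Only `C` is context in this premise, and its freeness at `d.dual` is what the universal
      -- interpolant at `d.dual` asks for.
      have h₁ := (hA d.dual ⟨b.imp ψ ::ₘ Γ', {a.imp b}⟩ (by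
        simp only [Sequent.weight, multisetWeight_cons, multisetWeight_singleton]
        omega)).weak _ C (by rwa [Polarity.dual_dual]) hC (by simpa using h₁)
      refine fun M w hw => hψ M w fun χ hχ => ?_
      simp only [Multiset.mem_add, Multiset.mem_singleton] at hχ
      rcases hχ with hχ | rfl
      · exact hw χ (Multiset.mem_add.2 (.inl hχ))
      · refine ((he _ _ rfl (.imp (.imp (E d (b.imp ψ ::ₘ Γ'))
          (A d.dual ⟨b.imp ψ ::ₘ Γ', {a.imp b}⟩)) (E d (ψ ::ₘ Γ')))
          (by simp [conjuncts, impConjuncts])).force (hw e (by simp))).mp fun v hv h' => h₁.force_of_add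
          (fun φ hφ => (hw φ (by simp [hφ])).mono hv) h'
    · simp only [mem_multisetVars_cons, mem_vars_imp, not_or, Polarity.dual_dual] at hC
      rw [Multiset.cons_add]
      refine .impImpL ?_ ?_ <;> rw [← Multiset.cons_add]
      · exact ih₁ (by simp; tauto) (by simp; tauto) (by simp)
      · exact ih₂ (by simp; tauto) hD (by simp)
  | weakL Θ Δ φ h ih =>
    simp only [Sequent.mk.injEq] at hS
    obtain ⟨hS, rfl⟩ := hS
    rcases cons_eq_add_split hS with ⟨Γ', rfl, rfl⟩ | ⟨C', rfl, rfl⟩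
    · refine ((hE d Γ' ?_).strong C D hC hD h).replace (he _ _ rfl _ (by simp [conjuncts]))
      have := φ.two_le_weight
      simp only [multisetWeight_cons] at hn; omega
    · rw [Multiset.cons_add]
      simp only [mem_multisetVars_cons, not_or] at hC
      exact (ih hC.2 hD rfl).weakL
  | weakR Θ φ h ih =>
    simp only [Sequent.mk.injEq] at hS
    obtain ⟨rfl, rfl⟩ := hS
    exact (ih hC (by simp) rfl).weakR
  | boxM φ ψ h =>
    simp only [Sequent.mk.injEq] at hS
    obtain ⟨hS, rfl⟩ := hS
    rcases cons_eq_add_split (a := φ.box) (r := 0) hS with ⟨Γ', hΓ, -⟩ | ⟨C', rfl, -⟩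
    · exact (hbox hΓ h (by simpa using hD)).of_subset (by simp)
    · exact (Valid.boxM h.valid).of_subset (by simp)
  | boxImpL Θ Δ φ ψ θ hφ h _ ih =>
    simp only [Sequent.mk.injEq] at hS
    obtain ⟨hS, rfl⟩ := hS
    rw [Multiset.cons_swap] at hS h
    rcases cons_eq_add_split hS with ⟨Γ', rfl, hΓ⟩ | ⟨C', rfl, hC'⟩
    · rw [hΓ] at h
      have hψ := (hE d (θ ::ₘ Γ') (hlt rfl)).strong C D hC hD (by simpa using h)
      rcases cons_eq_add_split hΓ.symm with ⟨Γ'', rfl, -⟩ | ⟨C', rfl, -⟩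
      · refine hψ.replace (he _ _ rfl _ ?_)
        rw [conjuncts, impConjuncts, if_pos ((Valid.boxM hφ.valid).of_subset (by simp))]
        simp
      · have hlt' : multisetWeight (0 : Multiset (Formula α)) < n ∧
            Sequent.weight ⟨0, {ψ}⟩ < n := by
          have := ψ.weight_box_lt
          have := ψ.box.weight_imp_lt θ
          simp only [Sequent.weight, multisetWeight_cons, multisetWeight_zero,
            multisetWeight_singleton] at hn ⊢
          omega
        -- The interpolant of the empty antecedent holds at every world, so the one required by
        -- `weak` costs nothing under the box.
        have h₀ := hE d 0 hlt'.1
        simp only [mem_multisetVars_cons, mem_vars_box, not_or] at hC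
        have h₁ := (hA d.dual ⟨0, {ψ}⟩ hlt'.2).weak _ {φ} (by rwa [Polarity.dual_dual])
          (by simpa using hC.1) (by simpa using hφ)
        refine fun M w hw => hψ M w fun χ hχ => ?_
        simp only [Multiset.mem_add, Multiset.mem_singleton] at hχ
        rcases hχ with hχ | rfl
        · exact hw χ (Multiset.mem_add.2 (.inl hχ))
        · have := (he _ _ rfl (.imp (.box (A d.dual ⟨0, {ψ}⟩)) (E d (θ ::ₘ Γ')))
            (by simp [conjuncts, impConjuncts])).force (hw e (by simp))
          refine this.mp (M.nbhd_superset (fun v hv => ?_) (hw φ.box (by simp)))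
          exact h₁.force_of_add (by simpa using hv) (by simpa using h₀.valid M v (by simp))
    · rw [Multiset.cons_add]
      have hih := @ih (θ ::ₘ C') D
      simp only [mem_multisetVars_cons, mem_vars_imp, not_or, Polarity.dual_dual,
        mem_vars_box] at hC hih
      refine .impL ?_ (by
        rw [← Multiset.cons_add]
        exact hih ⟨hC.1.2, hC.2⟩ hD (by
          rw [Multiset.add_cons, ← hC', Multiset.cons_swap]))
      rcases cons_eq_add_split hC'.symm with ⟨Γ'', hΓ, -⟩ | ⟨C', rfl, -⟩
      · exact (hbox hΓ hφ hC.1.1).of_subset (by simp)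
      · exact (Valid.boxM hφ.valid).of_subset (by simp)

/-- A formula that is implied by all disjuncts has the universal property of the universal
interpolant. -/
theorem forall_weak {d : Polarity} {Γ Δ : Multiset (Formula α)}
    (hE : ∀ d Γ', multisetWeight Γ' < n → IsExistsInterpolant d p Γ' (E d Γ'))
    (hA : ∀ d S, S.weight < n → IsForallInterpolant d p S (A d S))
    (hn : Sequent.weight ⟨Γ, Δ⟩ = n) {x : Formula α}
    (hL : ∀ φ Γ', Γ = φ ::ₘ Γ' → ∀ c ∈ leftDisjuncts E A d p Γ' Δ φ, Valid ⟨{c}, {x}⟩)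
    (hR : ∀ δ, Δ = {δ} → ∀ c ∈ rightDisjuncts E A d p Γ δ, Valid ⟨{c}, {x}⟩)
    (hT : Valid ⟨Γ, Δ⟩ → Valid ⟨0, {x}⟩) {e : Formula α}
    (he : IsExistsInterpolant d.dual p Γ e) {C : Multiset (Formula α)}
    (hC : p ∉ multisetVars d C) (h : Derivable ⟨Γ + C, Δ⟩) : Valid ⟨C + {e}, {x}⟩ := by
  generalize hS : (⟨Γ + C, Δ⟩ : Sequent α) = S at h
  simp only [Sequent.weight] at hn
  have hE' : ∀ Γ', multisetWeight Γ' < n → IsExistsInterpolant d.dual p Γ' (E d.dual Γ') :=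
    fun Γ' => hE d.dual Γ'
  -- The property `weak` of the smaller sequents, read pointwise so that it can be used at later
  -- worlds and inside neighbourhoods.
  have key : ∀ {Γ' Δ' C' : Multiset (Formula α)}, p ∉ multisetVars d C' →
      Derivable ⟨Γ' + C', Δ'⟩ → multisetWeight Γ' + multisetWeight Δ' < n →
      ∀ {M : Model α} {w : M.World}, (∀ φ ∈ C', M.Force w φ) →
      M.Force w (E d.dual Γ') → M.Force w (A d ⟨Γ', Δ'⟩) :=
    fun {Γ' _ _} hC' hd hlt _ _ hw hw' =>
      ((hA d ⟨Γ', _⟩ hlt).weak _ _ (hE' Γ' (by omega)) hC' hd).force_of_add hw hw'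
  have hlt : ∀ {a ψ Γ'}, Γ = .imp a ψ ::ₘ Γ' →
      multisetWeight (ψ ::ₘ Γ') + multisetWeight Δ < n := by
    rintro a ψ Γ' rfl
    have := a.weight_imp_lt ψ
    simp only [multisetWeight_cons] at hn ⊢; omega
  -- Only `C` varies. The given `e` enters through the suitably `p`-free consequences of `Γ`, in
  -- particular the smaller existential interpolants.
  induction h generalizing C with
  | ax Θ q =>
    simp only [Sequent.mk.injEq] at hS
    obtain ⟨hS, rfl⟩ := hS
    rcases cons_eq_add_split hS with ⟨Γ', rfl, rfl⟩ | ⟨C', rfl, rfl⟩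
    · exact (hT (.of_mem (by simp))).of_subset (by simp)
    · refine (hR _ rfl (.atom q) ?_).of_subset (by simp)
      simp only [mem_multisetVars_cons, mem_vars_atom, not_or] at hC
      simp only [rightDisjuncts]
      split_ifs with hq
      · exact (hC.1 ⟨hq.1.symm, hq.2⟩).elim
      · simp
  | botL Θ Δ hΔ =>
    simp only [Sequent.mk.injEq] at hS
    obtain ⟨hS, rfl⟩ := hS
    rcases cons_eq_add_split hS with ⟨Γ', rfl, rfl⟩ | ⟨C', rfl, rfl⟩
    · exact (hT .botL).of_subset (by simp)
    · rw [Multiset.cons_add]; exact .botL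
  | andL Θ Δ a b h ih =>
    simp only [Sequent.mk.injEq] at hS
    obtain ⟨hS, rfl⟩ := hS
    rcases cons_eq_add_split hS with ⟨Γ', rfl, rfl⟩ | ⟨C', rfl, rfl⟩
    · have := a.weight_and_lt b
      have hlt : multisetWeight (a ::ₘ b ::ₘ Γ') + multisetWeight Δ < n := by
        simp only [multisetWeight_cons] at hn ⊢; omega
      have h' := hE' (a ::ₘ b ::ₘ Γ') (by omega)
      refine .of_force_add fun M w hw hew =>
        (hL _ _ rfl (A d ⟨a ::ₘ b ::ₘ Γ', Δ⟩) (by simp [leftDisjuncts])).force ?_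
      exact key hC (by simpa using h) hlt hw (he.force_of h'.notMem (.andL h'.valid) hew)
    · rw [Multiset.cons_add]
      refine .andL ?_
      rw [← Multiset.cons_add, ← Multiset.cons_add]
      exact ih (by simpa [or_assoc] using hC) (by simp)
  | andR Θ a b h₁ h₂ _ _ =>
    simp only [Sequent.mk.injEq] at hS
    obtain ⟨rfl, rfl⟩ := hS
    have := a.weight_and_lt b
    simp only [multisetWeight_singleton] at hn
    have h' := hE' Γ (by omega)
    refine .of_force_add fun M w hw hew =>
      (hR _ rfl (.and (A d ⟨Γ, {a}⟩) (A d ⟨Γ, {b}⟩)) (by simp [rightDisjuncts])).force ?_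
    have hew := he.force_of h'.notMem h'.valid hew
    exact ⟨key hC h₁ (by simp only [multisetWeight_singleton]; omega) hw hew,
      key hC h₂ (by simp only [multisetWeight_singleton]; omega) hw hew⟩
  | orL Θ Δ a b h₁ h₂ ih₁ ih₂ =>
    simp only [Sequent.mk.injEq] at hS
    obtain ⟨hS, rfl⟩ := hS
    rcases cons_eq_add_split hS with ⟨Γ', rfl, rfl⟩ | ⟨C', rfl, rfl⟩
    · have := a.weight_or_lt b
      simp only [multisetWeight_cons] at hn
      refine .of_force_add fun M w hw hew =>
        (hL _ _ rfl (.and (.imp (E d.dual (a ::ₘ Γ')) (A d ⟨a ::ₘ Γ', Δ⟩))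
          (.imp (E d.dual (b ::ₘ Γ')) (A d ⟨b ::ₘ Γ', Δ⟩))) (by simp [leftDisjuncts])).force
          ⟨fun v hv hev => ?_, fun v hv hev => ?_⟩
      · exact key hC (by simpa using h₁) (by simp only [multisetWeight_cons]; omega)
          (fun φ hφ => (hw φ hφ).mono hv) hev
      · exact key hC (by simpa using h₂) (by simp only [multisetWeight_cons]; omega)
          (fun φ hφ => (hw φ hφ).mono hv) hev
    · simp only [mem_multisetVars_cons, mem_vars_or, not_or] at hC
      rw [Multiset.cons_add]
      refine .orL ?_ ?_ <;> rw [← Multiset.cons_add]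
      · exact ih₁ (by simpa using ⟨hC.1.1, hC.2⟩) (by simp)
      · exact ih₂ (by simpa using ⟨hC.1.2, hC.2⟩) (by simp)
  | orR₀ Θ a b h _ =>
    simp only [Sequent.mk.injEq] at hS
    obtain ⟨rfl, rfl⟩ := hS
    have := a.weight_or_lt b
    simp only [multisetWeight_singleton] at hn
    have h' := hE' Γ (by omega)
    exact .of_force_add fun M w hw hew =>
      (hR _ rfl (.or (A d ⟨Γ, {a}⟩) (A d ⟨Γ, {b}⟩)) (by simp [rightDisjuncts])).force
        (.inl (key hC h (by simp only [multisetWeight_singleton]; omega) hw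
          (he.force_of h'.notMem h'.valid hew)))
  | orR₁ Θ a b h _ =>
    simp only [Sequent.mk.injEq] at hS
    obtain ⟨rfl, rfl⟩ := hS
    have := a.weight_or_lt b
    simp only [multisetWeight_singleton] at hn
    have h' := hE' Γ (by omega)
    exact .of_force_add fun M w hw hew =>
      (hR _ rfl (.or (A d ⟨Γ, {a}⟩) (A d ⟨Γ, {b}⟩)) (by simp [rightDisjuncts])).force
        (.inr (key hC h (by simp only [multisetWeight_singleton]; omega) hw
          (he.force_of h'.notMem h'.valid hew)))
  | impR Θ a b h _ =>
    simp only [Sequent.mk.injEq] at hS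
    obtain ⟨rfl, rfl⟩ := hS
    have := a.weight_imp_lt b
    simp only [multisetWeight_singleton] at hn
    exact .of_force_add fun M w hw hew =>
      (hR _ rfl (.imp (E d.dual (a ::ₘ Γ)) (A d ⟨a ::ₘ Γ, {b}⟩))
        (by simp [rightDisjuncts])).force fun v hv hev =>
          key hC (by simpa using h)
            (by simp only [multisetWeight_cons, multisetWeight_singleton]; omega)
            (fun φ hφ => (hw φ hφ).mono hv) hev
  | atomImpL Θ Δ q ψ h ih =>
    simp only [Sequent.mk.injEq] at hS
    obtain ⟨hS, rfl⟩ := hS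
    rw [Multiset.cons_swap] at hS h
    rcases cons_eq_add_split hS with ⟨Γ', rfl, hΓ⟩ | ⟨C', rfl, hC'⟩
    · rw [hΓ] at h
      have hlt := hlt rfl
      have h' := hE' (ψ ::ₘ Γ') (by omega)
      refine .of_force_add fun M w hw hew => ?_
      have hψ := key (w := w) hC (by simpa using h) hlt hw
      rcases cons_eq_add_split hΓ.symm with ⟨Γ'', rfl, -⟩ | ⟨C', rfl, -⟩
      · refine (hL _ _ rfl _ ?_).force (hψ (he.force_of h'.notMem
          (.impL (.of_mem (by simp)) h'.valid) hew))
        rw [leftDisjuncts, impDisjuncts, if_pos (.of_mem (by simp))]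
        simp
      · simp only [mem_multisetVars_cons, mem_vars_atom, not_or] at hC
        have hq : ¬ (q = p ∧ d = .pos) := fun hq => hC.1 ⟨hq.1.symm, hq.2⟩
        have hqw : M.Force w (.atom q) := hw _ (by simp)
        refine (hL _ _ rfl (.and (.atom q) (A d ⟨ψ ::ₘ Γ', Δ⟩))
          (by simp [leftDisjuncts, impDisjuncts, hq])).force ⟨hqw, hψ ?_⟩
        -- `Γ` need not entail the interpolant of `ψ, Γ'` by itself, but does so together with `q`,
        -- which the context supplies.
        refine he.force_of_cons (φ := .atom q) ?_ h'.notMem ?_ hew hqw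
        · simpa using hC.1
        · rw [Multiset.cons_swap]
          exact .impL (.of_mem (by simp)) (h'.valid.of_subset (by simp +contextual))
    · rw [Multiset.cons_add]
      have hih := @ih (ψ ::ₘ C')
      simp only [mem_multisetVars_cons, mem_vars_imp, not_or, mem_vars_atom] at hC hih
      refine .impL ?_ (by
        rw [← Multiset.cons_add]
        exact hih ⟨hC.1.2, hC.2⟩ (by
          rw [Multiset.add_cons, ← hC', Multiset.cons_swap]))
      rcases cons_eq_add_split hC'.symm with ⟨Γ'', rfl, -⟩ | ⟨C', rfl, -⟩
      · refine fun M w hw => ⟨_, Multiset.mem_singleton_self _,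
          he.force_of ?_ (.of_mem (by simp)) (hw e (by simp))⟩
        simpa using hC.1.1
      · exact .of_mem (by simp)
  | andImpL Θ Δ a b ψ h ih =>
    simp only [Sequent.mk.injEq] at hS
    obtain ⟨hS, rfl⟩ := hS
    rcases cons_eq_add_split hS with ⟨Γ', rfl, rfl⟩ | ⟨C', rfl, rfl⟩
    · have := a.weight_and_imp_lt b ψ
      have hlt : multisetWeight (a.imp (b.imp ψ) ::ₘ Γ') + multisetWeight Δ < n := by
        simp only [multisetWeight_cons] at hn ⊢; omega
      have h' := hE' (a.imp (b.imp ψ) ::ₘ Γ') (by omega)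
      refine .of_force_add fun M w hw hew =>
        (hL _ _ rfl (A d ⟨a.imp (b.imp ψ) ::ₘ Γ', Δ⟩)
          (by simp [leftDisjuncts, impDisjuncts])).force ?_
      exact key hC (by simpa using h) hlt hw (he.force_of h'.notMem (.andImpL h'.valid) hew)
    · rw [Multiset.cons_add]
      refine .andImpL ?_
      rw [← Multiset.cons_add]
      exact ih (by simpa [or_assoc] using hC) (by simp)
  | orImpL Θ Δ a b ψ h ih =>
    simp only [Sequent.mk.injEq] at hS
    obtain ⟨hS, rfl⟩ := hS
    rcases cons_eq_add_split hS with ⟨Γ', rfl, rfl⟩ | ⟨C', rfl, rfl⟩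
    · have := a.weight_or_imp_lt b ψ
      have hlt : multisetWeight (a.imp ψ ::ₘ b.imp ψ ::ₘ Γ') + multisetWeight Δ < n := by
        simp only [multisetWeight_cons] at hn ⊢; omega
      have h' := hE' (a.imp ψ ::ₘ b.imp ψ ::ₘ Γ') (by omega)
      refine .of_force_add fun M w hw hew =>
        (hL _ _ rfl (A d ⟨a.imp ψ ::ₘ b.imp ψ ::ₘ Γ', Δ⟩)
          (by simp [leftDisjuncts, impDisjuncts])).force ?_
      exact key hC (by simpa using h) hlt hw (he.force_of h'.notMem (.orImpL h'.valid) hew)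
    · rw [Multiset.cons_add]
      refine .orImpL ?_
      rw [← Multiset.cons_add, ← Multiset.cons_add]
      refine ih ?_ (by simp)
      simp only [mem_multisetVars_cons, mem_vars_imp, mem_vars_or] at hC ⊢
      tauto
  | impImpL Θ Δ a b ψ h₁ h₂ _ ih₂ =>
    simp only [Sequent.mk.injEq] at hS
    obtain ⟨hS, rfl⟩ := hS
    rcases cons_eq_add_split hS with ⟨Γ', rfl, rfl⟩ | ⟨C', rfl, rfl⟩
    · have hlt := hlt rfl
      have h' := hE' (ψ ::ₘ Γ') (by omega)
      have hw₁ := a.weight_imp_imp_lt b ψ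
      simp only [multisetWeight_cons] at hn
      have hlt₁ : multisetWeight (b.imp ψ ::ₘ Γ') + multisetWeight {a.imp b} < n := by
        simp only [multisetWeight_cons, multisetWeight_singleton]; omega
      have h₁' := hE' (b.imp ψ ::ₘ Γ') (by omega)
      have h₂' := hA d ⟨b.imp ψ ::ₘ Γ', {a.imp b}⟩ hlt₁
      refine .of_force_add fun M w hw hew => ?_
      have himp : M.Force w (.imp (E d.dual (b.imp ψ ::ₘ Γ'))
          (A d ⟨b.imp ψ ::ₘ Γ', {a.imp b}⟩)) := fun v hv hev =>
        key hC (by simpa using h₁) hlt₁ (fun φ hφ => (hw φ hφ).mono hv) hev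
      refine (hL _ _ rfl (.and (.imp (E d.dual (b.imp ψ ::ₘ Γ'))
        (A d ⟨b.imp ψ ::ₘ Γ', {a.imp b}⟩)) (A d ⟨ψ ::ₘ Γ', Δ⟩))
        (by simp [leftDisjuncts, impDisjuncts])).force
        ⟨himp, key hC (by simpa using h₂) hlt hw ?_⟩
      -- `himp` is the first half of the disjunct. Together with `Γ` it yields `a → b`, hence `ψ`
      -- and the interpolant of `ψ, Γ'`, which is the hypothesis needed for the second half.
      refine he.force_of_cons ?_ h'.notMem ?_ hew himp
      · simpa using ⟨h₁'.notMem, h₂'.notMem⟩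
      · rw [Multiset.cons_swap]
        refine .impImpL (fun M w hw => h₂'.valid M w ?_)
          (h'.valid.of_subset (by simp +contextual))
        simp only [Multiset.forall_mem_cons] at hw ⊢
        refine ⟨hw.2.1.mp ?_, hw.1, hw.2.2⟩
        simpa using h₁'.valid M w (by simpa using ⟨hw.1, hw.2.2⟩)
    · simp only [mem_multisetVars_cons, mem_vars_imp, not_or, Polarity.dual_dual] at hC
      rw [Multiset.cons_add]
      refine .impImpL ?_ ?_ <;> rw [← Multiset.cons_add]
      -- This premise has its succedent in the context instead of `Δ`, so it is served by the
      -- universal property of `e`, not by the induction hypothesis.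
      · exact he.strong _ _ (by simp; tauto) (by simp; tauto) (by simpa using h₁)
      · exact ih₂ (by simp; tauto) (by simp)
  | weakL Θ Δ φ h ih =>
    simp only [Sequent.mk.injEq] at hS
    obtain ⟨hS, rfl⟩ := hS
    rcases cons_eq_add_split hS with ⟨Γ', rfl, rfl⟩ | ⟨C', rfl, rfl⟩
    · have := φ.two_le_weight
      simp only [multisetWeight_cons] at hn
      have h' := hE' Γ' (by omega)
      refine .of_force_add fun M w hw hew =>
        (hL _ _ rfl (A d ⟨Γ', Δ⟩) (by simp [leftDisjuncts])).force ?_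
      exact key hC h (by omega) hw (he.force_of h'.notMem h'.valid.weakL hew)
    · rw [Multiset.cons_add]
      simp only [mem_multisetVars_cons, not_or] at hC
      exact (ih hC.2 rfl).weakL
  | weakR Θ φ h _ =>
    simp only [Sequent.mk.injEq] at hS
    obtain ⟨rfl, rfl⟩ := hS
    -- `Γ` and `C` are contradictory, hence so are `e` and `C`.
    exact (he.strong C 0 (by simpa using hC) (by simp) h).weakR
  | boxM φ ψ h =>
    simp only [Sequent.mk.injEq] at hS
    obtain ⟨hS, rfl⟩ := hS
    rcases cons_eq_add_split (a := φ.box) (r := 0) hS with ⟨Γ', rfl, -⟩ | ⟨C', rfl, hΓ⟩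
    · exact (hT ((Valid.boxM h.valid).of_subset (by simp))).of_subset (by simp)
    · have := ψ.weight_box_lt
      simp only [multisetWeight_singleton] at hn
      simp only [mem_multisetVars_cons, mem_vars_box, not_or] at hC
      refine .of_force_add fun M w hw hew =>
        (hR _ rfl (.box (A d ⟨0, {ψ}⟩)) (by simp [rightDisjuncts])).force
          (M.nbhd_superset (fun v hv => ?_) (hw φ.box (by simp)))
      exact key (C' := {φ}) (by simpa using hC.1) (by simpa using h)
        (by simp only [multisetWeight_zero, multisetWeight_singleton]; omega)
        (by simpa using hv)
        (by simpa using (hE' 0 (by simp only [multisetWeight_zero]; omega)).valid M v (by simp))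
  | boxImpL Θ Δ φ ψ θ hφ h _ ih =>
    simp only [Sequent.mk.injEq] at hS
    obtain ⟨hS, rfl⟩ := hS
    rw [Multiset.cons_swap] at hS h
    rcases cons_eq_add_split hS with ⟨Γ', rfl, hΓ⟩ | ⟨C', rfl, hC'⟩
    · rw [hΓ] at h
      have hlt := hlt rfl
      have h' := hE' (θ ::ₘ Γ') (by omega)
      refine .of_force_add fun M w hw hew => ?_
      have hθ := key (w := w) hC (by simpa using h) hlt hw
      rcases cons_eq_add_split hΓ.symm with ⟨Γ'', rfl, -⟩ | ⟨C', rfl, -⟩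
      · have hv := Valid.boxM hφ.valid
        refine (hL _ _ rfl _ ?_).force (hθ (he.force_of h'.notMem
          (.impL (hv.of_subset (by simp)) h'.valid) hew))
        rw [leftDisjuncts, impDisjuncts, if_pos (hv.of_subset (by simp))]
        simp
      · simp only [mem_multisetVars_cons, mem_vars_box, not_or] at hC
        have hlt₀ : multisetWeight (0 : Multiset (Formula α)) + multisetWeight {ψ} < n := by
          have := ψ.weight_box_lt
          have := ψ.box.weight_imp_lt θ
          simp only [multisetWeight_cons, multisetWeight_zero, multisetWeight_singleton] at hn ⊢
          omega
        have h₀ := hA d ⟨0, {ψ}⟩ hlt₀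
        have hbox : M.Force w (.box (A d ⟨0, {ψ}⟩)) :=
          M.nbhd_superset (fun v hv => key (C' := {φ}) (by simpa using hC.1) (by simpa using hφ)
            hlt₀ (by simpa using hv)
            (by simpa using (hE' 0 (by omega)).valid M v (by simp))) (hw φ.box (by simp))
        refine (hL _ _ rfl (.and (.box (A d ⟨0, {ψ}⟩)) (A d ⟨θ ::ₘ Γ', Δ⟩))
          (by simp [leftDisjuncts, impDisjuncts])).force ⟨hbox, hθ ?_⟩
        refine he.force_of_cons ?_ h'.notMem ?_ hew hbox
        · simpa using h₀.notMem
        · rw [Multiset.cons_swap]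
          exact .impL ((Valid.boxM h₀.valid).of_subset (by simp))
            (h'.valid.of_subset (by simp +contextual))
    · rw [Multiset.cons_add]
      have hih := @ih (θ ::ₘ C')
      simp only [mem_multisetVars_cons, mem_vars_imp, not_or, mem_vars_box] at hC hih
      refine .impL ?_ (by
        rw [← Multiset.cons_add]
        exact hih ⟨hC.1.2, hC.2⟩ (by
          rw [Multiset.add_cons, ← hC', Multiset.cons_swap]))
      have hv := Valid.boxM hφ.valid
      rcases cons_eq_add_split hC'.symm with ⟨Γ'', rfl, -⟩ | ⟨C', rfl, -⟩
      · exact fun M w hw => ⟨_, Multiset.mem_singleton_self _,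
          he.force_of (by simpa using hC.1.1) (hv.of_subset (by simp)) (hw e (by simp))⟩
      · exact hv.of_subset (by simp)

end step

/-! ### Existence of the interpolants -/

/-- Each kind uses both kinds at smaller weights. At equal weight the halves are independent, as
`weak` quantifies over all existential interpolants of the antecedent. -/
theorem exists_interpolants (p : α) (n : ℕ) :
    (∀ d Γ, multisetWeight Γ = n → ∃ e, IsExistsInterpolant d p Γ e) ∧
      ∀ d S, S.weight = n → ∃ a, IsForallInterpolant d p S a := by
  classical
  induction n using Nat.strong_induction_on with
  | _ n ih =>
  have hE : ∀ d Γ, ∃ e, multisetWeight Γ < n → IsExistsInterpolant d p Γ e := fun d Γ => by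
    by_cases h : multisetWeight Γ < n
    · obtain ⟨e, he⟩ := (ih _ h).1 d Γ rfl
      exact ⟨e, fun _ => he⟩
    · exact ⟨.bot, fun h' => (h h').elim⟩
  have hA : ∀ d S, ∃ a, S.weight < n → IsForallInterpolant d p S a := fun d S => by
    by_cases h : S.weight < n
    · obtain ⟨e, he⟩ := (ih _ h).2 d S rfl
      exact ⟨e, fun _ => he⟩
    · exact ⟨.bot, fun h' => (h h').elim⟩
  choose E hE using hE
  choose A hA using hA
  constructor
  · intro d Γ hn
    let l : List (Formula α) := Γ.toList.flatMap fun φ => conjuncts E A d p (Γ.erase φ) φ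
    have hl : ∀ c ∈ l, ∃ φ Γ', Γ = φ ::ₘ Γ' ∧ c ∈ conjuncts E A d p Γ' φ := by
      intro c hc
      obtain ⟨φ, hφ, hc⟩ := List.mem_flatMap.1 hc
      exact ⟨φ, _, (Multiset.cons_erase (Multiset.mem_toList.1 hφ)).symm, hc⟩
    refine ⟨conj l, ?_, fun M w hw => ⟨_, Multiset.mem_singleton_self _, ?_⟩, ?_⟩
    · intro c q hq
      obtain ⟨φ, hφ, hqφ⟩ := mem_vars_conj.1 hq
      obtain ⟨ψ, Γ', rfl, h⟩ := hl φ hφ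
      exact (conjuncts_spec hE hA hn h).2 c q hqφ
    · refine force_conj.2 fun φ hφ => ?_
      obtain ⟨ψ, Γ', rfl, h⟩ := hl φ hφ
      simpa using (conjuncts_spec hE hA hn h).1 M w hw
    · refine fun C D hC hD h => exists_strong hE hA hn ?_ hC hD h
      rintro φ Γ' rfl c hc M w hw
      refine ⟨c, Multiset.mem_singleton_self _, force_conj.1 (hw (conj l) (by simp)) c ?_⟩
      exact List.mem_flatMap.2 ⟨φ, by simp, by simpa using hc⟩
  · rintro d ⟨Γ, Δ⟩ hn
    let l : List (Formula α) :=
      (Γ.toList.flatMap fun φ => leftDisjuncts E A d p (Γ.erase φ) Δ φ) ++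
      (Δ.toList.flatMap fun δ => rightDisjuncts E A d p Γ δ) ++
      -- The disjunct `⊤` accounts for axioms and instances of rule `M` that need no formula of the
      -- context.
      if Valid ⟨Γ, Δ⟩ then [conj []] else []
    have hl : ∀ c ∈ l, Valid ⟨c ::ₘ Γ, Δ⟩ ∧
        ∀ b q, q ∈ c.vars b → q ∈ Sequent.vars b ⟨Γ, Δ⟩ ∧ ¬ (q = p ∧ b = d) := by
      intro c hc
      simp only [l, List.mem_append, List.mem_flatMap, Multiset.mem_toList] at hc
      rcases hc with (⟨φ, hφ, hc⟩ | ⟨δ, hδ, hc⟩) | hc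
      · obtain ⟨Γ', rfl⟩ := Multiset.exists_cons_of_mem hφ
        exact leftDisjuncts_spec hE hA hn (by simpa using hc)
      · obtain ⟨Δ', rfl⟩ := Multiset.exists_cons_of_mem hδ
        obtain ⟨h₁, h₂⟩ := rightDisjuncts_spec hE hA hn hc
        refine ⟨fun M w hw => ⟨δ, by simp, by simpa using h₁ M w hw⟩, fun b q hq => ?_⟩
        have := h₂ b q hq
        simp only [Sequent.mem_vars_mk, mem_multisetVars_singleton,
          mem_multisetVars_cons] at this ⊢
        tauto
      · split_ifs at hc with hv
        · simp only [List.mem_singleton] at hc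
          subst hc
          exact ⟨hv.weakL, by simp [conj]⟩
        · simp at hc
    have hle : ∀ c ∈ l, Valid ⟨{c}, {disj l}⟩ := fun c hc M w hw =>
      ⟨_, Multiset.mem_singleton_self _, force_disj.2 ⟨c, hc, hw c (by simp)⟩⟩
    refine ⟨disj l, ?_, fun M w hw => ?_, ?_⟩
    · intro b q hq
      obtain ⟨φ, hφ, hq⟩ := mem_vars_disj.1 hq
      exact (hl φ hφ).2 b q hq
    · simp only [Multiset.forall_mem_cons] at hw
      obtain ⟨φ, hφ, hwφ⟩ := force_disj.1 hw.1
      exact (hl φ hφ).1 M w (by simpa using ⟨hwφ, hw.2⟩)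
    · refine fun e C he hC h => forall_weak hE hA hn ?_ ?_ ?_ he hC h
      · rintro φ Γ' rfl c hc
        refine hle c (List.mem_append_left _ (List.mem_append_left _ ?_))
        exact List.mem_flatMap.2 ⟨φ, by simp, by simpa using hc⟩
      · rintro δ rfl c hc
        refine hle c (List.mem_append_left _ (List.mem_append_right _ ?_))
        exact List.mem_flatMap.2 ⟨δ, by simp, hc⟩
      · refine fun hv => (hle (conj []) ?_).trans fun φ hφ M w _ => ?_
        · exact List.mem_append_right _ (by rw [if_pos hv]; simp)
        · rw [Multiset.mem_singleton] at hφ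
          subst hφ
          exact ⟨_, Multiset.mem_singleton_self _, force_conj.2 (by simp)⟩

end G4iM

/-- Uniform Lyndon interpolation for `G4iM`. The formula `A d p S` is the uniform universal
interpolant of the sequent `S`, and `E d p Γ` is the uniform existential interpolant of the
multiset `Γ`, at the atom `p` and the polarity `d`. -/
theorem mainTheorem2 {α : Type*} :
    ∃ (A : G4iM.Polarity → α → G4iM.Sequent α → G4iM.Formula α)
      (E : G4iM.Polarity → α → Multiset (G4iM.Formula α) → G4iM.Formula α),
      ∀ (S : G4iM.Sequent α) (Γ : Multiset (G4iM.Formula α)) (p : α) (d : G4iM.Polarity),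
        S.IsSingleConclusion →
        -- the variable conditions
        (p ∉ (A d p S).vars d ∧ p ∉ (E d p Γ).vars d ∧
          ∀ e : G4iM.Polarity, (A d p S).vars e ⊆ S.vars e ∧
            (E d p Γ).vars e ⊆ G4iM.multisetVars e Γ) ∧
        -- (i)
        G4iM.Derivable ⟨Γ, {E d p Γ}⟩ ∧
        -- (ii)
        (∀ T : G4iM.Sequent α, T.IsSingleConclusion → p ∉ T.vars d →
          G4iM.Derivable (G4iM.Sequent.mul ⟨Γ, 0⟩ T) →
          G4iM.Derivable (G4iM.Sequent.mul ⟨{E d p Γ}, 0⟩ T)) ∧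
        -- (iii)
        G4iM.Derivable (S.mul ⟨{A d p S}, 0⟩) ∧
        -- (iv)
        (∀ C : Multiset (G4iM.Formula α), p ∉ G4iM.multisetVars d C →
          G4iM.Derivable (S.mul ⟨C, 0⟩) →
          G4iM.Derivable ⟨E d.dual p S.ant ::ₘ C, {A d p S}⟩) := by
  have hE : ∀ (d : G4iM.Polarity) (p : α) Γ, ∃ e, G4iM.IsExistsInterpolant d p Γ e :=
    fun d p Γ => (G4iM.exists_interpolants p _).1 d Γ rfl
  have hA : ∀ (d : G4iM.Polarity) (p : α) S, ∃ a, G4iM.IsForallInterpolant d p S a :=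
    fun d p S => (G4iM.exists_interpolants p _).2 d S rfl
  choose E hE using hE
  choose A hA using hA
  refine ⟨A, E, fun S Γ p d hS => ⟨⟨(hA d p S).notMem, (hE d p Γ).notMem, fun e =>
    ⟨fun q hq => ((hA d p S).vars e q hq).1, fun q hq => ((hE d p Γ).vars e q hq).1⟩⟩,
    ?_, ?_, ?_, ?_⟩⟩
  · exact (hE d p Γ).valid.derivable (by simp [G4iM.Sequent.IsSingleConclusion])
  · rintro ⟨C, D⟩ hT hp h
    simp only [G4iM.Sequent.mem_vars_mk, not_or] at hp
    simp only [G4iM.Sequent.mul, zero_add] at h ⊢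
    rw [add_comm]
    exact ((hE d p Γ).strong C D hp.1 hp.2 h).derivable hT
  · refine G4iM.Valid.derivable (by simpa [G4iM.Sequent.IsSingleConclusion, G4iM.Sequent.mul]
      using hS) ?_
    simpa [G4iM.Sequent.mul, add_comm S.ant] using (hA d p S).valid
  · intro C hC h
    refine G4iM.Valid.derivable (by simp [G4iM.Sequent.IsSingleConclusion]) ?_
    rw [← Multiset.singleton_add, add_comm]
    exact (hA d p S).weak _ C (hE d.dual p S.ant) hC (by simpa [G4iM.Sequent.mul] using h)
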